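/- Let $d \ge 1$ and work with complex-valued tempered distributions on $\mathbb{R}^d$. Fix a smooth radial function $\chi : \mathbb{R}^d \to \mathbb{R}$ supported in the ball $B(0,2)$, equal to $1$ in a neighborhood of the closed unit ball and such that $r \mapsto \chi(re)$ is nonincreasing on $[0,\infty)$ for every unit vector $e$. Set $\varphi(\xi) = \chi(\xi) - \chi(2\xi)$ and, for $m \in \mathbb{Z}$, $\dot\Delta_m f = \mathcal{F}^{-1}\big[\varphi(2^{-m}\xi)\widehat f(\xi)\big]$ for $f \in \mathcal{S}'$. For $s \in \mathbb{R}$, let $\dot B^s_{1,\infty}$ be the space of classes $f$ of tempered distributions modulo polynomials (with complex coefficients) such that $$\|f\|_{\dot B^s_{1,\infty}} = \sup_{m \in \mathbb{Z}} 2^{ms}\|\dot\Delta_m f\|_{L^1} < +\infty ,$$ with this norm. Let $\mathcal{S}'_h$ be the space of those $f \in \mathcal{S}'$ such that $\chi(\lambda\xi)\widehat f(\xi) \to 0$ in $\mathcal{S}'$ as $\lambda \to +\infty$, and let $C^s_1$ be the closure in $\dot B^s_{1,\infty}$ of $\mathcal{S}'_h \cap \dot B^s_{1,\infty}$, the set of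 the elements of $\dot B^s_{1,\infty}$ that are the class modulo polynomials of some element of $\mathcal{S}'_h$. Let $s \ge d$. Then $C^s_1$ is not complemented in $\dot B^s_{1,\infty}$: there is no decomposition $\dot B^s_{1,\infty} = C^s_1 \oplus G$, with $G$ a linear subspace, for which the associated projections are continuous. -/

import Mathlib

open MeasureTheory Filter Topology FourierTransform
open scoped SchwartzMap ENNReal ContDiff

noncomputable section

namespace Chemin

/-- The Euclidean space `ℝ^d`. -/
abbrev Rd (d : ℕ) : Type := EuclideanSpace ℝ (Fin d)

/-- Complex-valued tempered distributions on `ℝ^d`. -/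
abbrev TD (d : ℕ) : Type := 𝓢'(Rd d, ℂ)

/-! ### The dyadic partition of unity -/

/-- A low frequency cut-off function: smooth, radial, supported in the ball `B(0, 2)`, equal to `1`
in a neighbourhood of the unit ball, and nonincreasing along every ray issued from the origin. -/
structure Cutoff (d : ℕ) where
  /-- the cut-off function itself -/
  toFun : Rd d → ℝ
  smooth : ContDiff ℝ ∞ toFun
  radial : ∀ ξ η : Rd d, ‖ξ‖ = ‖η‖ → toFun ξ = toFun η
  tsupport_subset : tsupport toFun ⊆ Metric.closedBall 0 2
  eq_one : ∀ᶠ ξ in 𝓝ˢ (Metric.closedBall (0 : Rd d) 1), toFun ξ = 1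
  antitone : ∀ e : Rd d, ‖e‖ = 1 → AntitoneOn (fun r : ℝ ↦ toFun (r • e)) (Set.Ici 0)

variable {d : ℕ}

/-- The function `φ(ξ) = χ(ξ) - χ(2ξ)`. -/
def Cutoff.phi (χ : Cutoff d) (ξ : Rd d) : ℝ := χ.toFun ξ - χ.toFun ((2 : ℝ) • ξ)

/-- The symbol `φ_m(ξ) = φ(2^{-m} ξ)`, as a complex-valued function. -/
def Cutoff.symbol (χ : Cutoff d) (m : ℤ) (ξ : Rd d) : ℂ := (χ.phi (((2 : ℝ) ^ (-m)) • ξ) : ℂ)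

/-- The homogeneous dyadic block `Δ̇_m = φ(2^{-m} D)` on tempered distributions. -/
def block (χ : Cutoff d) (m : ℤ) : TD d →L[ℂ] TD d :=
  TemperedDistribution.fourierMultiplierCLM ℂ (χ.symbol m)

/-! ### Polynomials as tempered distributions -/

/-- The function on `ℝ^d` given by a polynomial with complex coefficients. -/
def polyFun (P : MvPolynomial (Fin d) ℂ) (x : Rd d) : ℂ :=
  MvPolynomial.eval (fun i ↦ (x i : ℂ)) P

lemma hasTemperateGrowth_coord (i : Fin d) :
    (fun x : Rd d ↦ ((x i : ℝ) : ℂ)).HasTemperateGrowth :=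
  Function.HasTemperateGrowth.comp Function.Complex.hasTemperateGrowth_ofReal
    (ContinuousLinearMap.hasTemperateGrowth (EuclideanSpace.proj (𝕜 := ℝ) i : Rd d →L[ℝ] ℝ))

lemma hasTemperateGrowth_polyFun (P : MvPolynomial (Fin d) ℂ) :
    (polyFun P).HasTemperateGrowth := by
  induction P using MvPolynomial.induction_on with
  | C a =>
    have : polyFun (MvPolynomial.C a) = fun _ : Rd d ↦ a := by ext x; simp [polyFun]
    rw [this]; exact .const a
  | add p q hp hq =>
    have : polyFun (p + q) = polyFun p + polyFun q := by ext x; simp [polyFun]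
    rw [this]; exact hp.add hq
  | mul_X p i hp =>
    have : polyFun (p * MvPolynomial.X i) = polyFun p * fun x : Rd d ↦ ((x i : ℝ) : ℂ) := by
      ext x; simp [polyFun]
    rw [this]; exact hp.mul (hasTemperateGrowth_coord i)

/-- The tempered distribution `u ↦ ∫ u P` defined by a polynomial `P`. -/
def polyDist (P : MvPolynomial (Fin d) ℂ) : TD d :=
  (hasTemperateGrowth_polyFun P).toTemperedDistribution volume

lemma polyDist_apply (P : MvPolynomial (Fin d) ℂ) (u : 𝓢(Rd d, ℂ)) :
    polyDist P u = ∫ x, u x * polyFun P x := by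
  simp [polyDist]

lemma integrable_mul_polyFun (P : MvPolynomial (Fin d) ℂ) (u : 𝓢(Rd d, ℂ)) :
    Integrable (fun x ↦ u x * polyFun P x) := by
  have h := (SchwartzMap.smulLeftCLM ℂ (polyFun P) u).integrable (μ := volume)
  refine h.congr (Eventually.of_forall fun x ↦ ?_)
  simp [SchwartzMap.smulLeftCLM_apply_apply (hasTemperateGrowth_polyFun P), mul_comm]

/-- The embedding of polynomials into tempered distributions. -/
def polyDistₗ (d : ℕ) : MvPolynomial (Fin d) ℂ →ₗ[ℂ] TD d where
  toFun := polyDist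
  map_add' P Q := by
    ext u
    change _ = polyDist P u + polyDist Q u
    rw [polyDist_apply, polyDist_apply, polyDist_apply,
      ← integral_add (integrable_mul_polyFun P u) (integrable_mul_polyFun Q u)]
    simp [polyFun, mul_add]
  map_smul' c P := by
    ext u
    change _ = c * polyDist P u
    rw [polyDist_apply, polyDist_apply, ← integral_const_mul]
    simp [polyFun, mul_left_comm]

/-- The space of polynomials, as a subspace of the space of tempered distributions. -/
def polys (d : ℕ) : Submodule ℂ (TD d) := LinearMap.range (polyDistₗ d)

/-! ### Dyadic blocks annihilate polynomials -/

lemma Cutoff.hasTemperateGrowth_symbol (χ : Cutoff d) (m : ℤ) :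
    (χ.symbol m).HasTemperateGrowth := by
  have hc : HasCompactSupport χ.toFun :=
    HasCompactSupport.intro (isCompact_closedBall (0 : Rd d) 2) fun x hx ↦
      image_eq_zero_of_notMem_tsupport fun h ↦ hx (χ.tsupport_subset h)
  have hg : χ.toFun.HasTemperateGrowth := hc.hasTemperateGrowth χ.smooth
  have hs : ∀ c : ℝ, (fun ξ : Rd d ↦ χ.toFun (c • ξ)).HasTemperateGrowth := fun c ↦
    Function.HasTemperateGrowth.comp hg
      (ContinuousLinearMap.hasTemperateGrowth (c • ContinuousLinearMap.id ℝ (Rd d)))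
  have h : (fun ξ : Rd d ↦ χ.toFun (((2 : ℝ) ^ (-m)) • ξ) -
      χ.toFun ((2 * (2 : ℝ) ^ (-m)) • ξ)).HasTemperateGrowth := (hs _).sub (hs _)
  have h' := Function.HasTemperateGrowth.comp Function.Complex.hasTemperateGrowth_ofReal h
  have he : χ.symbol m = Complex.ofReal ∘ fun ξ : Rd d ↦ χ.toFun (((2 : ℝ) ^ (-m)) • ξ) -
      χ.toFun ((2 * (2 : ℝ) ^ (-m)) • ξ) := by
    funext ξ
    simp only [Cutoff.symbol, Cutoff.phi, smul_smul, Function.comp_apply]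
  rw [he]
  exact h'

lemma Cutoff.symbol_eventually_eq_zero (χ : Cutoff d) (m : ℤ) :
    ∀ᶠ ξ in 𝓝 (0 : Rd d), χ.symbol m ξ = 0 := by
  have h1 : ∀ᶠ ξ in 𝓝 (0 : Rd d), χ.toFun ξ = 1 :=
    χ.eq_one.filter_mono (nhds_le_nhdsSet (by simp))
  have hc : ∀ c : ℝ, Tendsto (fun ξ : Rd d ↦ c • ξ) (𝓝 0) (𝓝 0) := fun c ↦ by
    have : Continuous fun ξ : Rd d ↦ c • ξ := by fun_prop
    simpa using this.tendsto 0
  filter_upwards [(hc ((2 : ℝ) ^ (-m))).eventually h1,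
    (hc (2 * (2 : ℝ) ^ (-m))).eventually h1] with ξ h2 h3
  simp only [Cutoff.symbol, Cutoff.phi, smul_smul, h2, h3, sub_self, Complex.ofReal_zero]

open LineDeriv in
/-- The Fourier transform of a polynomial is supported at the origin. -/
lemma polyDist_fourier_eq_zero (P : MvPolynomial (Fin d) ℂ) :
    ∀ h : 𝓢(Rd d, ℂ), (∀ᶠ ξ in 𝓝 (0 : Rd d), h ξ = 0) → polyDist P (𝓕 h) = 0 := by
  induction P using MvPolynomial.induction_on with
  | C a =>
    intro h hh
    have h0 : 𝓕⁻ (𝓕 h) (0 : Rd d) = h 0 := by rw [FourierTransform.fourierInv_fourier_eq]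
    rw [SchwartzMap.fourierInv_coe, Real.fourierInv_eq] at h0
    simp only [inner_zero_right, AddChar.map_zero_eq_one, one_smul, hh.self_of_nhds] at h0
    rw [polyDist_apply]
    simp only [polyFun, MvPolynomial.eval_C]
    rw [integral_mul_const, h0, zero_mul]
  | add p q hp hq =>
    intro h hh
    have := (polyDistₗ d).map_add p q
    change polyDist (p + q) = polyDist p + polyDist q at this
    rw [this]
    change polyDist p _ + polyDist q _ = 0
    rw [hp h hh, hq h hh, add_zero]
  | mul_X p i hp =>
    intro h hh
    set e : Rd d := EuclideanSpace.single i 1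
    have hd : ∀ᶠ ξ in 𝓝 (0 : Rd d), (∂_{e} h) ξ = 0 := by
      have h2 : ∀ᶠ ξ in 𝓝 (0 : Rd d), (h : Rd d → ℂ) =ᶠ[𝓝 ξ] fun _ ↦ 0 :=
        eventually_eventually_nhds.2 hh
      filter_upwards [h2] with ξ hξ
      rw [SchwartzMap.lineDerivOp_apply_eq_fderiv, hξ.fderiv_eq]
      simp
    have h3 := hp _ hd
    have hg : (inner ℝ · e : Rd d → ℝ).HasTemperateGrowth := by fun_prop
    rw [SchwartzMap.fourier_lineDerivOp_eq, map_smul, smul_eq_mul, mul_eq_zero] at h3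
    have h4 := h3.resolve_left Complex.two_pi_I_ne_zero
    rw [polyDist_apply] at h4 ⊢
    rw [← h4]
    refine integral_congr_ae (Eventually.of_forall fun x ↦ ?_)
    simp only [SchwartzMap.smulLeftCLM_apply_apply hg]
    simp [polyFun, e, EuclideanSpace.inner_single_right]
    ring

lemma polys_le_ker_block (χ : Cutoff d) (m : ℤ) :
    polys d ≤ LinearMap.ker (block χ m).toLinearMap := by
  rintro _ ⟨P, rfl⟩
  rw [LinearMap.mem_ker]
  ext u
  change polyDist P (𝓕 (SchwartzMap.smulLeftCLM ℂ (χ.symbol m) (𝓕⁻ u))) = 0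
  refine polyDist_fourier_eq_zero P _ ?_
  filter_upwards [χ.symbol_eventually_eq_zero m] with ξ hξ
  rw [SchwartzMap.smulLeftCLM_apply_apply (χ.hasTemperateGrowth_symbol m), hξ, zero_smul]

/-! ### Homogeneous Besov spaces with third index `∞` -/

/-- The space of tempered distributions modulo polynomials. -/
abbrev TDModPoly (d : ℕ) : Type := TD d ⧸ polys d

/-- The dyadic block `Δ̇_m`, acting on tempered distributions modulo polynomials. -/
def blockQ (χ : Cutoff d) (m : ℤ) : TDModPoly d →ₗ[ℂ] TD d :=
  (polys d).liftQ (block χ m).toLinearMap (polys_le_ker_block χ m)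

/-- The `L^p` norm of a tempered distribution: it is `∞` if the distribution is not (given by) an
`L^p` function. -/
def lpENorm (p : ℝ≥0∞) [Fact (1 ≤ p)] (T : TD d) : ℝ≥0∞ :=
  ⨅ (g : Lp ℂ p (volume : Measure (Rd d))) (_ : Lp.toTemperedDistribution g = T), ‖g‖ₑ

lemma lpENorm_coe (p : ℝ≥0∞) [Fact (1 ≤ p)] (g : Lp ℂ p (volume : Measure (Rd d))) :
    lpENorm p (Lp.toTemperedDistribution g) = ‖g‖ₑ := by
  refine le_antisymm (iInf_le_of_le g (iInf_le_of_le rfl le_rfl)) (le_iInf₂ fun g' hg' ↦ ?_)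
  have hk := Lp.ker_toTemperedDistributionCLM_eq_bot (F := ℂ) (μ := (volume : Measure (Rd d)))
    (p := p)
  rw [LinearMap.ker_eq_bot.1 hk hg']

lemma lpENorm_zero (p : ℝ≥0∞) [Fact (1 ≤ p)] : lpENorm p (0 : TD d) = 0 := by
  have h := lpENorm_coe p (0 : Lp ℂ p (volume : Measure (Rd d)))
  rwa [enorm_zero, show Lp.toTemperedDistribution (0 : Lp ℂ p (volume : Measure (Rd d))) = 0 from
    (Lp.toTemperedDistributionCLM ℂ volume p).map_zero] at h

lemma lpENorm_add_le (p : ℝ≥0∞) [Fact (1 ≤ p)] (S T : TD d) :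
    lpENorm p (S + T) ≤ lpENorm p S + lpENorm p T := by
  simp only [lpENorm, ENNReal.iInf_add, ENNReal.add_iInf]
  refine le_iInf₂ fun g' hg' ↦ le_iInf₂ fun g hg ↦ ?_
  refine iInf_le_of_le (g + g') (iInf_le_of_le ?_ (enorm_add_le g g'))
  rw [← hg, ← hg']
  exact (Lp.toTemperedDistributionCLM ℂ volume p).map_add g g'

lemma lpENorm_smul_le (p : ℝ≥0∞) [Fact (1 ≤ p)] (c : ℂ) (T : TD d) :
    lpENorm p (c • T) ≤ ‖c‖ₑ * lpENorm p T := by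
  rcases eq_or_ne c 0 with rfl | hc
  · rw [show (0 : ℂ) • T = 0 from zero_smul ℂ T, lpENorm_zero]
    exact bot_le
  simp only [lpENorm, ENNReal.mul_iInf_of_ne (enorm_ne_zero.2 hc) enorm_ne_top]
  refine le_iInf₂ fun g hg ↦ ?_
  refine iInf_le_of_le (c • g) (iInf_le_of_le ?_ (enorm_smul c g).le)
  rw [← hg]
  exact (Lp.toTemperedDistributionCLM ℂ volume p).map_smul c g

/-- The homogeneous Besov norm `sup_m 2^{ms} ‖Δ̇_m f‖_{L^p}` (with values in `[0, ∞]`) of a class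
of tempered distributions modulo polynomials. -/
def besovENorm (χ : Cutoff d) (s : ℝ) (p : ℝ≥0∞) [Fact (1 ≤ p)] (f : TDModPoly d) : ℝ≥0∞ :=
  ⨆ m : ℤ, ENNReal.ofReal ((2 : ℝ) ^ ((m : ℝ) * s)) * lpENorm p (blockQ χ m f)

lemma besovENorm_zero (χ : Cutoff d) (s : ℝ) (p : ℝ≥0∞) [Fact (1 ≤ p)] :
    besovENorm χ s p 0 = 0 := by
  simp [besovENorm, lpENorm_zero]

lemma besovENorm_add_le (χ : Cutoff d) (s : ℝ) (p : ℝ≥0∞) [Fact (1 ≤ p)] (f g : TDModPoly d) :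
    besovENorm χ s p (f + g) ≤ besovENorm χ s p f + besovENorm χ s p g := by
  refine iSup_le fun m ↦ ?_
  calc _ ≤ ENNReal.ofReal ((2 : ℝ) ^ ((m : ℝ) * s)) *
        (lpENorm p (blockQ χ m f) + lpENorm p (blockQ χ m g)) := by
        rw [map_add]; gcongr; exact lpENorm_add_le p _ _
    _ ≤ _ := by
        rw [mul_add]
        exact add_le_add (le_iSup (fun m : ℤ ↦ ENNReal.ofReal ((2 : ℝ) ^ ((m : ℝ) * s)) *
          lpENorm p (blockQ χ m f)) m) (le_iSup (fun m : ℤ ↦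
          ENNReal.ofReal ((2 : ℝ) ^ ((m : ℝ) * s)) * lpENorm p (blockQ χ m g)) m)

lemma besovENorm_smul_le (χ : Cutoff d) (s : ℝ) (p : ℝ≥0∞) [Fact (1 ≤ p)] (c : ℂ)
    (f : TDModPoly d) : besovENorm χ s p (c • f) ≤ ‖c‖ₑ * besovENorm χ s p f := by
  refine iSup_le fun m ↦ ?_
  calc _ ≤ ENNReal.ofReal ((2 : ℝ) ^ ((m : ℝ) * s)) * (‖c‖ₑ * lpENorm p (blockQ χ m f)) := by
        rw [map_smul]; gcongr; exact lpENorm_smul_le p _ _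
    _ = ‖c‖ₑ * (ENNReal.ofReal ((2 : ℝ) ^ ((m : ℝ) * s)) * lpENorm p (blockQ χ m f)) := by ring
    _ ≤ _ := by
        gcongr
        exact le_iSup (fun m : ℤ ↦ ENNReal.ofReal ((2 : ℝ) ^ ((m : ℝ) * s)) *
          lpENorm p (blockQ χ m f)) m

/-- The classes modulo polynomials of finite homogeneous Besov norm, as a subspace of the space of
tempered distributions modulo polynomials. -/
def besovSubmodule (χ : Cutoff d) (s : ℝ) (p : ℝ≥0∞) [Fact (1 ≤ p)] :
    Submodule ℂ (TDModPoly d) where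
  carrier := {f | besovENorm χ s p f < ⊤}
  zero_mem' := by simp [besovENorm_zero]
  add_mem' {f g} hf hg :=
    (besovENorm_add_le χ s p f g).trans_lt (ENNReal.add_lt_top.2 ⟨hf, hg⟩)
  smul_mem' c f hf :=
    (besovENorm_smul_le χ s p c f).trans_lt (ENNReal.mul_lt_top enorm_lt_top hf)

/-- The homogeneous Besov space `Ḃ^s_{p,∞}`. It is a type of its own so that it carries the
topology of the Besov norm, and not the one inherited from tempered distributions. -/
def Besov (χ : Cutoff d) (s : ℝ) (p : ℝ≥0∞) [Fact (1 ≤ p)] : Type := besovSubmodule χ s p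

section
variable (χ : Cutoff d) (s : ℝ) (p : ℝ≥0∞) [Fact (1 ≤ p)]

instance : AddCommGroup (Besov χ s p) := inferInstanceAs (AddCommGroup (besovSubmodule χ s p))

instance : Module ℂ (Besov χ s p) := inferInstanceAs (Module ℂ (besovSubmodule χ s p))

/-- The inclusion of `Ḃ^s_{p,∞}` into the space of tempered distributions modulo polynomials. -/
def Besov.incl : Besov χ s p →ₗ[ℂ] TDModPoly d := (besovSubmodule χ s p).subtype

instance : Norm (Besov χ s p) := ⟨fun f ↦ (besovENorm χ s p (Besov.incl χ s p f)).toReal⟩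

lemma Besov.norm_def (f : Besov χ s p) :
    ‖f‖ = (besovENorm χ s p (Besov.incl χ s p f)).toReal := rfl

lemma Besov.enorm_ne_top (f : Besov χ s p) : besovENorm χ s p (Besov.incl χ s p f) ≠ ⊤ :=
  ne_of_lt f.2

lemma Besov.norm_smul_le' (c : ℂ) (f : Besov χ s p) : ‖c • f‖ ≤ ‖c‖ * ‖f‖ := by
  rw [norm_def, norm_def, map_smul, ← toReal_enorm c, ← ENNReal.toReal_mul]
  exact ENNReal.toReal_mono (ENNReal.mul_ne_top _root_.enorm_ne_top (enorm_ne_top χ s p f))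
    (besovENorm_smul_le χ s p c _)

lemma Besov.core : SeminormedSpace.Core ℂ (Besov χ s p) where
  norm_nonneg f := ENNReal.toReal_nonneg
  norm_smul c f := by
    refine le_antisymm (norm_smul_le' χ s p c f) ?_
    rcases eq_or_ne c 0 with rfl | hc
    · rw [norm_zero, zero_mul]; exact ENNReal.toReal_nonneg
    · have h := norm_smul_le' χ s p c⁻¹ (c • f)
      rw [inv_smul_smul₀ hc, norm_inv] at h
      rwa [← le_inv_mul_iff₀ (norm_pos_iff.2 hc)]
  norm_triangle f g := by
    rw [norm_def, norm_def, norm_def, map_add,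
      ← ENNReal.toReal_add (enorm_ne_top χ s p f) (enorm_ne_top χ s p g)]
    exact ENNReal.toReal_mono
      (ENNReal.add_ne_top.2 ⟨enorm_ne_top χ s p f, enorm_ne_top χ s p g⟩)
      (besovENorm_add_le χ s p _ _)

instance : SeminormedAddCommGroup (Besov χ s p) :=
  SeminormedAddCommGroup.ofCore (Besov.core χ s p)

instance : NormedSpace ℂ (Besov χ s p) where
  norm_smul_le := Besov.norm_smul_le' χ s p

end

/-! ### Chemin's space and the closure of its trace on Besov spaces -/

/-- Chemin's space `𝓢'_h`: the tempered distributions `f` such that `χ(t ξ) f̂(ξ)` tends to `0` in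
the space of tempered distributions as `t → +∞`. -/
def sPrimeH (χ : Cutoff d) : Submodule ℂ (TD d) where
  carrier := {f | Tendsto (fun t : ℝ ↦ TemperedDistribution.smulLeftCLM ℂ
    (fun ξ : Rd d ↦ (χ.toFun (t • ξ) : ℂ)) (𝓕 f)) atTop (𝓝 0)}
  zero_mem' := by
    have : 𝓕 (0 : TD d) = 0 := (fourierCLM ℂ (TD d)).map_zero
    simp [this]
  add_mem' {f g} hf hg := by
    simpa [FourierTransform.fourier_add] using Tendsto.add hf hg
  smul_mem' c f hf := by
    have h := Tendsto.const_smul hf c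
    rw [show c • (0 : TD d) = 0 by ext u; exact mul_zero c] at h
    simpa [FourierTransform.fourier_smul] using h

/-- The intersection `𝓢'_h ∩ Ḃ^s_{p,∞}`: the elements of `Ḃ^s_{p,∞}` which are the class modulo
polynomials of an element of `𝓢'_h`. -/
def sPrimeHInter (χ : Cutoff d) (s : ℝ) (p : ℝ≥0∞) [Fact (1 ≤ p)] : Submodule ℂ (Besov χ s p) :=
  ((sPrimeH χ).map (polys d).mkQ).comap (Besov.incl χ s p)

/-- The space `C^s_p`: the closure of `𝓢'_h ∩ Ḃ^s_{p,∞}` in `Ḃ^s_{p,∞}`. -/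
def closureC (χ : Cutoff d) (s : ℝ) (p : ℝ≥0∞) [Fact (1 ≤ p)] : Submodule ℂ (Besov χ s p) :=
  (sPrimeHInter χ s p).topologicalClosure

end Chemin

end

noncomputable section

namespace Chemin

/-! ### Almost disjoint families and uncomplemented subspaces -/

/-! The pair (`ℓ^∞`, `c₀`) sits inside (`Ḃ^s_{1,∞}`, `C^s_1`), and Whitley's proof that `c₀` is not
complemented in `ℓ^∞` transfers.

Take a bump `b` in frequency, supported where only the zeroth dyadic symbol is nonzero and equals
one. For bounded `a`, the series `∑ a_k 2^{ks} 𝓕⁻¹[b(2^k ξ)]`, renormalised at `ξ = 0` so that it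
converges, has the `k`-th term as its block of index `-k` (`exists_block_eq`). The `L¹` norm is
invariant under these dilations, so the Besov norm of the sum is at most a constant times `sup
|a_k|`. Finitely supported sequences give spectra away from the origin, hence elements of `C^s_1`.

Conversely, the functionals `lowFreq` are bounded uniformly in `k` and send the series to `a_k ∫ b`.
For `s ≥ d` they tend to `0` on `𝓢'_h`, hence on its closure (`tendsto_lowFreq_of_mem_closureC`). A
series in `C^s_1` thus has `a_k → 0`.

Let `a` run over the indicators of an uncountable almost disjoint family of infinite sets. Modulo
finitely many terms, finite combinations with coefficients of modulus at most one remain bounded. If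
`P` were a continuous projection onto `C^s_1`, each functional composed with `1 - P` would be
nonzero on only countably many of these series. Countably many functionals detect the norm, since
`L¹` is separable and there are countably many blocks. Some series would therefore lie in `C^s_1`
(`exists_mem_of_isTopCompl`), although its coefficients equal `1` infinitely often. -/

/-- There is an uncountable family of infinite sets of integers with finite pairwise
intersections. -/
lemma exists_almost_disjoint_family :
    ∃ A : (ℕ → Bool) → Set ℕ, (∀ x, (A x).Infinite) ∧ ∀ x y, x ≠ y → (A x ∩ A y).Finite := by
  -- Branches of the binary tree: `A x` is the set of codes of the finite prefixes of `x`. Two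
  -- distinct branches share no prefix longer than the first index where they differ.
  let code : (ℕ → Bool) → ℕ → ℕ := fun x n ↦ Encodable.encode ((List.range n).map x)
  have hcode : ∀ x y n p, code x n = code y p → n = p ∧ ∀ j < n, x j = y j := by
    intro x y n p h
    have h1 := Encodable.encode_injective h
    have h2 : n = p := by simpa using congrArg List.length h1
    subst h2
    refine ⟨rfl, fun j hj ↦ ?_⟩
    exact List.map_inj_left.1 h1 j (List.mem_range.2 hj)
  refine ⟨fun x ↦ Set.range (code x), fun x ↦ ?_, fun x y hxy ↦ ?_⟩
  · exact Set.infinite_range_of_injective fun n p h ↦ (hcode x x n p h).1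
  · obtain ⟨j, hj⟩ := Function.ne_iff.1 hxy
    refine ((Set.finite_Iic j).image (code x)).subset ?_
    rintro _ ⟨⟨n, rfl⟩, ⟨p, hp⟩⟩
    refine ⟨n, ?_, rfl⟩
    by_contra h
    exact hj ((hcode x y n p hp.symm).2 j (not_le.1 h))

/-- If a continuous linear functional is bounded, up to a subspace on which it vanishes, on all
sums of vectors of a family with coefficients of modulus at most one, then it vanishes on all but
countably many vectors of this family. -/
lemma countable_setOf_apply_ne_zero {X ι : Type*} [SeminormedAddCommGroup X] [NormedSpace ℂ X]
    {C : Submodule ℂ X} {f : ι → X} {K : ℝ}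
    (hf : ∀ (F : Finset ι) (c : ι → ℂ), (∀ i, ‖c i‖ ≤ 1) →
      ∃ h ∈ C, ‖∑ i ∈ F, c i • f i - h‖ ≤ K)
    (L : X →L[ℂ] ℂ) (hL : ∀ x ∈ C, L x = 0) : {i | L (f i) ≠ 0}.Countable := by
  have hsum : ∀ F : Finset ι, ∑ i ∈ F, ‖L (f i)‖ ≤ ‖L‖ * K := by
    intro F
    -- The phases `c i` align all the values, so that `L` of the combination is the full sum of the
    -- `‖L (f i)‖`.
    have hc : ∀ i, ∃ c : ℂ, ‖c‖ ≤ 1 ∧ c * L (f i) = (‖L (f i)‖ : ℂ) := by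
      intro i
      rcases eq_or_ne (L (f i)) 0 with h | h
      · exact ⟨0, by simp, by simp [h]⟩
      · have h' : (‖L (f i)‖ : ℂ) ≠ 0 := by simpa using h
        refine ⟨(‖L (f i)‖ : ℂ) / L (f i), ?_, div_mul_cancel₀ _ h⟩
        rw [norm_div, Complex.norm_real, norm_norm, div_self (norm_ne_zero_iff.2 h)]
    choose c hc1 hc2 using hc
    obtain ⟨h, hhC, hh⟩ := hf F c hc1
    have e : L (∑ i ∈ F, c i • f i - h) = ((∑ i ∈ F, ‖L (f i)‖ : ℝ) : ℂ) := by
      rw [map_sub, hL h hhC, sub_zero, map_sum]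
      push_cast
      exact Finset.sum_congr rfl fun i _ ↦ by rw [map_smul, smul_eq_mul, hc2]
    have h3 := (L.le_opNorm (∑ i ∈ F, c i • f i - h)).trans
      (mul_le_mul_of_nonneg_left hh (norm_nonneg L))
    rw [e, Complex.norm_real, Real.norm_of_nonneg (by positivity)] at h3
    exact h3
  have hs : Summable fun i ↦ ‖L (f i)‖ :=
    summable_of_sum_le (fun i ↦ norm_nonneg _) hsum
  simpa [Function.support] using hs.countable_support

/-- Whitley's argument: if countably many functionals detect the vectors of positive norm, a
topologically complemented closed subspace contains a member of any uncountable family that is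
unconditionally bounded modulo this subspace. -/
theorem exists_mem_of_isTopCompl {X ι κ : Type*} [SeminormedAddCommGroup X] [NormedSpace ℂ X]
    [Uncountable ι] [Countable κ] {C G : Submodule ℂ X} (hC : IsClosed (C : Set X))
    (hG : C.IsTopCompl G) (Λ : κ → X →L[ℂ] ℂ) (hΛ : ∀ x, (∀ j, Λ j x = 0) → ‖x‖ = 0)
    {f : ι → X} {K : ℝ}
    (hf : ∀ (F : Finset ι) (c : ι → ℂ), (∀ i, ‖c i‖ ≤ 1) →
      ∃ h ∈ C, ‖∑ i ∈ F, c i • f i - h‖ ≤ K) : ∃ i, f i ∈ C := by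
  let P : X →L[ℂ] X := C.projectionL G hG
  let Q : X →L[ℂ] X := ContinuousLinearMap.id ℂ X - P
  have hP : ∀ x, P x ∈ C := fun x ↦ (C.projectionOntoL G hG x).2
  have hPC : ∀ x ∈ C, P x = x := fun x hx ↦
    congrArg Subtype.val (Submodule.projectionOntoL_apply_left hG ⟨x, hx⟩)
  have hQC : ∀ x ∈ C, Q x = 0 := fun x hx ↦ by
    change x - P x = 0
    rw [hPC x hx, sub_self]
  have hPG : ∀ x, P (Q x) = 0 := fun x ↦ by
    change P (x - P x) = 0
    rw [map_sub, hPC _ (hP x), sub_self]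
  have hcount : (⋃ j, {i | Λ j (Q (f i)) ≠ 0}).Countable :=
    Set.countable_iUnion fun j ↦ countable_setOf_apply_ne_zero hf ((Λ j).comp Q)
      fun x hx ↦ by simp [hQC x hx]
  have hne : (⋃ j, {i | Λ j (Q (f i)) ≠ 0}) ≠ Set.univ := fun h ↦
    Set.not_countable_univ (h ▸ hcount)
  obtain ⟨i, hi⟩ := (Set.ne_univ_iff_exists_notMem _).1 hne
  refine ⟨i, ?_⟩
  have h0 : ‖Q (f i)‖ = 0 := hΛ _ fun j ↦ by
    by_contra h
    exact hi (Set.mem_iUnion.2 ⟨j, h⟩)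
  -- The norm is only known to be a seminorm, so `Q (f i)` need not be zero yet; but a closed
  -- subspace contains every vector of seminorm zero, and `P` both fixes and kills `Q (f i)`.
  have hQ : Q (f i) ∈ C := by
    have : Q (f i) ∈ closure (C : Set X) := by
      refine Metric.mem_closure_iff.2 fun ε hε ↦ ⟨0, C.zero_mem, ?_⟩
      rw [dist_zero_right, h0]
      exact hε
    rwa [hC.closure_eq] at this
  have h1 : Q (f i) = 0 := by rw [← hPC _ hQ, hPG]
  have h2 : f i = P (f i) := sub_eq_zero.1 h1
  rw [h2]
  exact hP _

/-- Countably many continuous functionals separate the points of a separable normed space. -/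
lemma exists_seq_functional_separating (E : Type*) [NormedAddCommGroup E] [NormedSpace ℂ E]
    [TopologicalSpace.SeparableSpace E] :
    ∃ Λ : ℕ → E →L[ℂ] ℂ, ∀ x, (∀ n, Λ n x = 0) → x = 0 := by
  obtain ⟨u, hu⟩ := TopologicalSpace.exists_dense_seq E
  choose Λ h1 h2 using fun n ↦ exists_dual_vector'' ℂ (u n)
  refine ⟨Λ, fun x hx ↦ ?_⟩
  by_contra hne
  have hpos : 0 < ‖x‖ := norm_pos_iff.2 hne
  obtain ⟨n, hn⟩ := Metric.denseRange_iff.1 hu x (‖x‖ / 2) (half_pos hpos)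
  rw [dist_eq_norm] at hn
  -- `Λ n` norms `u n` and kills `x`, so `‖u n‖` is the value of `Λ n` at `u n - x`, up to sign.
  -- With `u n` within `‖x‖ / 2` of `x` this is contradictory.
  have h3 : ‖u n‖ ≤ ‖x - u n‖ := by
    have h4 := (Λ n).le_of_opNorm_le (h1 n) (x - u n)
    rw [map_sub, hx n, h2 n, zero_sub, norm_neg, one_mul] at h4
    simpa using h4
  have h5 : ‖x‖ ≤ ‖x - u n‖ + ‖u n‖ := by simpa using norm_add_le (x - u n) (u n)
  linarith

variable {d : ℕ}

/-! ### Taylor polynomials of Schwartz functions at the origin -/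

/-- The Taylor polynomial of order `N` of a Schwartz function at the origin. -/
def taylorZero (N : ℕ) (u : 𝓢(Rd d, ℂ)) (ξ : Rd d) : ℂ :=
  ∑ j ∈ Finset.range (N + 1), ((j.factorial : ℝ)⁻¹) • iteratedFDeriv ℝ j u 0 (fun _ ↦ ξ)

lemma continuous_taylorZero (N : ℕ) (u : 𝓢(Rd d, ℂ)) : Continuous (taylorZero N u) := by
  unfold taylorZero
  refine continuous_finsetSum _ fun j _ ↦ ?_
  have h : Continuous fun ξ : Rd d ↦ iteratedFDeriv ℝ j u 0 fun _ ↦ ξ :=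
    (iteratedFDeriv ℝ j u 0).cont.comp (continuous_pi fun _ ↦ continuous_id)
  exact h.const_smul ((j.factorial : ℝ)⁻¹)

lemma taylorZero_add (N : ℕ) (u v : 𝓢(Rd d, ℂ)) (ξ : Rd d) :
    taylorZero N (u + v) ξ = taylorZero N u ξ + taylorZero N v ξ := by
  simp only [taylorZero, ← Finset.sum_add_distrib, ← smul_add]
  refine Finset.sum_congr rfl fun j _ ↦ ?_
  have h : iteratedFDeriv ℝ j (⇑(u + v)) 0 = iteratedFDeriv ℝ j u 0 + iteratedFDeriv ℝ j v 0 :=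
    iteratedFDeriv_add_apply ((u.smooth j).contDiffAt) ((v.smooth j).contDiffAt)
  rw [h]; rfl

lemma taylorZero_smul (N : ℕ) (c : ℂ) (u : 𝓢(Rd d, ℂ)) (ξ : Rd d) :
    taylorZero N (c • u) ξ = c * taylorZero N u ξ := by
  simp only [taylorZero, Finset.mul_sum]
  refine Finset.sum_congr rfl fun j _ ↦ ?_
  have h : iteratedFDeriv ℝ j (⇑(c • u)) 0 = c • iteratedFDeriv ℝ j u 0 :=
    iteratedFDeriv_const_smul_apply ((u.smooth j).contDiffAt)
  rw [h]
  simp [mul_left_comm]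

lemma taylorZero_eq_zero (N : ℕ) {u : 𝓢(Rd d, ℂ)} (hu : ∀ᶠ ξ in 𝓝 (0 : Rd d), u ξ = 0)
    (ξ : Rd d) : taylorZero N u ξ = 0 := by
  refine Finset.sum_eq_zero fun j _ ↦ ?_
  have h : (u : Rd d → ℂ) =ᶠ[𝓝 0] fun _ ↦ 0 := hu
  rw [Filter.EventuallyEq.eq_of_nhds (Filter.EventuallyEq.iteratedFDeriv ℝ h j)]
  simp

/-- One-dimensional Taylor formula for `t ↦ u (t ξ)` on `[0, 1]`; the factor `1 / N!` is discarded.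
-/
lemma norm_sub_taylorZero_le (N : ℕ) (u : 𝓢(Rd d, ℂ)) (ξ : Rd d) :
    ‖u ξ - taylorZero N u ξ‖ ≤ ‖ξ‖ ^ (N + 1) * SchwartzMap.seminorm ℂ 0 (N + 1) u := by
  let ℓ : ℝ →L[ℝ] Rd d := (ContinuousLinearMap.id ℝ ℝ).smulRight ξ
  let g : ℝ → ℂ := u ∘ ℓ
  have hg : ContDiff ℝ ∞ g := (u.smooth ⊤).comp ℓ.contDiff
  have hder : ∀ (j : ℕ) (t : ℝ), iteratedDeriv j g t = iteratedFDeriv ℝ j u (t • ξ) fun _ ↦ ξ := by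
    intro j t
    rw [iteratedDeriv_eq_iteratedFDeriv, ℓ.iteratedFDeriv_comp_right (u.smooth ⊤) t
      (mod_cast le_top)]
    simp [ℓ]
  have hU : UniqueDiffOn ℝ (Set.Icc (0 : ℝ) 1) := uniqueDiffOn_Icc one_pos
  have hw : ∀ (j : ℕ), ∀ t ∈ Set.Icc (0 : ℝ) 1,
      iteratedDerivWithin j g (Set.Icc 0 1) t = iteratedFDeriv ℝ j u (t • ξ) fun _ ↦ ξ :=
    fun j t ht ↦ by
      rw [iteratedDerivWithin_eq_iteratedDeriv hU ((hg.of_le (mod_cast le_top)).contDiffAt) ht,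
        hder]
  have h := taylor_mean_remainder_bound (f := g) (n := N) (x := 1) (zero_le_one (α := ℝ))
    (hg.of_le (mod_cast le_top)).contDiffOn (Set.right_mem_Icc.2 zero_le_one)
    (C := ‖ξ‖ ^ (N + 1) * SchwartzMap.seminorm ℂ 0 (N + 1) u) fun t ht ↦ by
      rw [hw _ t ht]
      refine (ContinuousMultilinearMap.le_opNorm _ _).trans ?_
      rw [Finset.prod_const, Finset.card_univ, Fintype.card_fin, mul_comm]
      gcongr
      exact u.norm_iteratedFDeriv_le_seminorm ℂ (N + 1) (t • ξ)
  have h1 : taylorWithinEval g N (Set.Icc 0 1) 0 1 = taylorZero N u ξ := by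
    rw [taylor_within_apply, taylorZero]
    refine Finset.sum_congr rfl fun j _ ↦ ?_
    rw [hw j 0 (Set.left_mem_Icc.2 zero_le_one)]
    simp
  have h2 : g 1 = u ξ := by simp [g, ℓ]
  rw [h1, h2] at h
  refine h.trans (div_le_of_le_mul₀ (by positivity) (by positivity) ?_)
  rw [sub_zero, one_pow, mul_one]
  exact le_mul_of_one_le_right (by positivity) (mod_cast Nat.one_le_iff_ne_zero.2
    (Nat.factorial_ne_zero N))

/-! ### Dilations -/

/-- The dilation `ξ ↦ b (2^k ξ)` of a Schwartz function. -/
def dil (k : ℕ) : 𝓢(Rd d, ℂ) →L[ℂ] 𝓢(Rd d, ℂ) :=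
  SchwartzMap.compCLMOfContinuousLinearEquiv ℂ
    (ContinuousLinearEquiv.smulLeft (R₁ := ℝ) (Units.mk0 ((2 : ℝ) ^ k) (by positivity)))

lemma dil_apply (k : ℕ) (b : 𝓢(Rd d, ℂ)) (ξ : Rd d) : dil k b ξ = b ((2 : ℝ) ^ k • ξ) := rfl

lemma integral_comp_two_pow_smul {F : Type*} [NormedAddCommGroup F] [NormedSpace ℝ F] (k : ℕ)
    (g : Rd d → F) : ∫ ξ, g ((2 : ℝ) ^ k • ξ) = ((2 : ℝ) ^ (k * d))⁻¹ • ∫ ξ, g ξ := by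
  rw [Measure.integral_comp_smul_of_nonneg _ _ _ (hR := by positivity)]
  simp [pow_mul]

lemma fourierInv_dil (k : ℕ) (b : 𝓢(Rd d, ℂ)) (x : Rd d) :
    𝓕⁻ (dil k b) x = ((2 : ℝ) ^ (k * d))⁻¹ • 𝓕⁻ b (((2 : ℝ) ^ k)⁻¹ • x) := by
  rw [SchwartzMap.fourierInv_coe, SchwartzMap.fourierInv_coe, Real.fourierInv_eq,
    Real.fourierInv_eq, ← integral_comp_two_pow_smul]
  refine integral_congr_ae (Eventually.of_forall fun ξ ↦ ?_)
  simp only [dil_apply, inner_smul_left, inner_smul_right]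
  have : (2 : ℝ) ^ k ≠ 0 := by positivity
  simp [this]

lemma integral_norm_fourierInv_dil (k : ℕ) (b : 𝓢(Rd d, ℂ)) :
    ∫ x, ‖𝓕⁻ (dil k b) x‖ = ∫ x, ‖𝓕⁻ b x‖ := by
  have h : ∀ x, ‖𝓕⁻ b (((2 : ℝ) ^ k)⁻¹ • x)‖ = (2 : ℝ) ^ (k * d) * ‖𝓕⁻ (dil k b) x‖ := by
    intro x
    rw [fourierInv_dil, norm_smul, norm_inv, Real.norm_of_nonneg (by positivity),
      mul_inv_cancel_left₀ (by positivity)]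
  have h2 := integral_comp_two_pow_smul k fun x ↦ ‖𝓕⁻ b (((2 : ℝ) ^ k)⁻¹ • x)‖
  have h3 : (2 : ℝ) ^ k ≠ 0 := by positivity
  have h4 : (2 : ℝ) ^ (k * d) ≠ 0 := by positivity
  simp only [inv_smul_smul₀ h3] at h2
  rw [h2]
  simp only [h]
  rw [integral_const_mul, smul_eq_mul, inv_mul_cancel_left₀ h4]

/-! ### Lacunary series in frequency space -/

/-- The pairing of a dilated Schwartz function with a Taylor remainder at the origin. -/
def taylorPairing (N : ℕ) (b : 𝓢(Rd d, ℂ)) (k : ℕ) (u : 𝓢(Rd d, ℂ)) : ℂ :=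
  ∫ ξ, dil k b ξ * (u ξ - taylorZero N u ξ)

lemma norm_dil_mul_sub_taylorZero_le (N : ℕ) (b : 𝓢(Rd d, ℂ)) (k : ℕ) (u : 𝓢(Rd d, ℂ))
    (ξ : Rd d) : ‖dil k b ξ * (u ξ - taylorZero N u ξ)‖ ≤
      (‖ξ‖ ^ (N + 1) * ‖dil k b ξ‖) * SchwartzMap.seminorm ℂ 0 (N + 1) u := by
  rw [norm_mul]
  calc _ ≤ ‖dil k b ξ‖ * (‖ξ‖ ^ (N + 1) * SchwartzMap.seminorm ℂ 0 (N + 1) u) := by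
        gcongr; exact norm_sub_taylorZero_le N u ξ
    _ = _ := by ring

lemma integrable_dil_mul_sub_taylorZero (N : ℕ) (b : 𝓢(Rd d, ℂ)) (k : ℕ) (u : 𝓢(Rd d, ℂ)) :
    Integrable fun ξ ↦ dil k b ξ * (u ξ - taylorZero N u ξ) :=
  (((dil k b).integrable_pow_mul volume (N + 1)).mul_const _).mono'
    ((dil k b).continuous.mul (u.continuous.sub (continuous_taylorZero N u))).aestronglyMeasurable
    (Eventually.of_forall (norm_dil_mul_sub_taylorZero_le N b k u))

/-- The remainder vanishes to order `N + 1` at the origin, where `dil k b` concentrates at scale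
`2^{-k}`: this gains `2^{-k(N+1)}`. The Jacobian `2^{-kd}` is bounded by one. -/
lemma norm_taylorPairing_le (N : ℕ) (b : 𝓢(Rd d, ℂ)) (k : ℕ) (u : 𝓢(Rd d, ℂ)) :
    ‖taylorPairing N b k u‖ ≤ ((2 : ℝ) ^ (k * (N + 1)))⁻¹ *
      (∫ ξ, ‖ξ‖ ^ (N + 1) * ‖b ξ‖) * SchwartzMap.seminorm ℂ 0 (N + 1) u := by
  have h0 : ∀ ξ : Rd d, ‖ξ‖ ^ (N + 1) * ‖dil k b ξ‖ = ((2 : ℝ) ^ (k * (N + 1)))⁻¹ *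
      (‖(2 : ℝ) ^ k • ξ‖ ^ (N + 1) * ‖b ((2 : ℝ) ^ k • ξ)‖) := by
    intro ξ
    have : (2 : ℝ) ^ k ≠ 0 := by positivity
    rw [dil_apply, norm_smul, Real.norm_of_nonneg (by positivity), mul_pow, pow_mul]
    field_simp
  have hnn : 0 ≤ ∫ ξ : Rd d, ‖ξ‖ ^ (N + 1) * ‖b ξ‖ := integral_nonneg fun ξ ↦ by positivity
  calc _ ≤ ∫ ξ, (‖ξ‖ ^ (N + 1) * ‖dil k b ξ‖) * SchwartzMap.seminorm ℂ 0 (N + 1) u :=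
        norm_integral_le_of_norm_le (((dil k b).integrable_pow_mul volume (N + 1)).mul_const _)
          (Eventually.of_forall (norm_dil_mul_sub_taylorZero_le N b k u))
    _ = ((2 : ℝ) ^ (k * (N + 1)))⁻¹ * (((2 : ℝ) ^ (k * d))⁻¹ *
          ∫ ξ, ‖ξ‖ ^ (N + 1) * ‖b ξ‖) * SchwartzMap.seminorm ℂ 0 (N + 1) u := by
        rw [integral_mul_const]
        simp only [h0]
        rw [integral_const_mul, integral_comp_two_pow_smul k fun ξ : Rd d ↦
          ‖ξ‖ ^ (N + 1) * ‖b ξ‖, smul_eq_mul]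
    _ ≤ _ := by
        gcongr
        exact mul_le_of_le_one_left hnn (inv_le_one_of_one_le₀ (one_le_pow₀ one_le_two))

lemma norm_lacunary_term_le {s : ℝ} {N : ℕ} (hN : s ≤ N) (b : 𝓢(Rd d, ℂ)) {a : ℕ → ℂ} {K : ℝ}
    (ha : ∀ k, ‖a k‖ ≤ K) (k : ℕ) (u : 𝓢(Rd d, ℂ)) :
    ‖a k * ((2 : ℝ) ^ ((k : ℝ) * s) : ℝ) * taylorPairing N b k u‖ ≤ (1 / 2) ^ k *
      ((K * ∫ ξ, ‖ξ‖ ^ (N + 1) * ‖b ξ‖) * SchwartzMap.seminorm ℂ 0 (N + 1) u) := by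
  have hnn : 0 ≤ ∫ ξ : Rd d, ‖ξ‖ ^ (N + 1) * ‖b ξ‖ := integral_nonneg fun ξ ↦ by positivity
  have h1 : (2 : ℝ) ^ ((k : ℝ) * s) ≤ 2 ^ (k * N) := by
    rw [← Real.rpow_natCast]
    push_cast
    gcongr
    exact one_le_two
  rw [norm_mul, norm_mul, Complex.norm_real, Real.norm_of_nonneg (by positivity)]
  have hK : 0 ≤ K := (norm_nonneg _).trans (ha k)
  calc _ ≤ K * 2 ^ (k * N) * (((2 : ℝ) ^ (k * (N + 1)))⁻¹ *
      (∫ ξ, ‖ξ‖ ^ (N + 1) * ‖b ξ‖) * SchwartzMap.seminorm ℂ 0 (N + 1) u) := by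
        gcongr
        · exact ha k
        · exact norm_taylorPairing_le N b k u
    _ = _ := by
        rw [mul_add, pow_add, mul_one, one_div, inv_pow]
        field_simp

lemma summable_lacunary {s : ℝ} {N : ℕ} (hN : s ≤ N) (b : 𝓢(Rd d, ℂ)) {a : ℕ → ℂ} {K : ℝ}
    (ha : ∀ k, ‖a k‖ ≤ K) (u : 𝓢(Rd d, ℂ)) :
    Summable fun k : ℕ ↦ a k * ((2 : ℝ) ^ ((k : ℝ) * s) : ℝ) * taylorPairing N b k u :=
  Summable.of_norm_bounded (summable_geometric_two.mul_right _)
    fun k ↦ norm_lacunary_term_le hN b ha k u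

/-- A tempered distribution given by a lacunary series of dilated Schwartz functions, whose terms
are renormalised at the origin. -/
theorem exists_lacunary_distribution (s : ℝ) (b : 𝓢(Rd d, ℂ)) {a : ℕ → ℂ} {K : ℝ}
    (ha : ∀ k, ‖a k‖ ≤ K) : ∃ (N : ℕ) (T : TD d), ∀ u,
      T u = ∑' k : ℕ, a k * ((2 : ℝ) ^ ((k : ℝ) * s) : ℝ) * taylorPairing N b k u := by
  -- With `N ≥ s`, the gain `2^{-k(N+1)}` beats the weight `2^{ks}` by a factor `2^{-k}`.
  -- Subtracting a Taylor polynomial changes each term only by a distribution supported at the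
  -- origin in frequency, which the dyadic blocks do not see.
  obtain ⟨N, hN⟩ := exists_nat_ge s
  have hnn : 0 ≤ ∫ ξ : Rd d, ‖ξ‖ ^ (N + 1) * ‖b ξ‖ := integral_nonneg fun ξ ↦ by positivity
  have hK : 0 ≤ K := (norm_nonneg _).trans (ha 0)
  have hadd : ∀ k u v, taylorPairing N b k (u + v) =
      taylorPairing N b k u + taylorPairing N b k v := fun k u v ↦ by
    simp only [taylorPairing]
    rw [← integral_add (integrable_dil_mul_sub_taylorZero N b k u)
      (integrable_dil_mul_sub_taylorZero N b k v)]
    refine integral_congr_ae (Eventually.of_forall fun ξ ↦ ?_)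
    simp only [taylorZero_add, add_apply]
    ring
  have hsmul : ∀ k (c : ℂ) u, taylorPairing N b k (c • u) = c * taylorPairing N b k u :=
    fun k c u ↦ by
      simp only [taylorPairing]
      rw [← integral_const_mul]
      refine integral_congr_ae (Eventually.of_forall fun ξ ↦ ?_)
      simp only [taylorZero_smul, smul_apply, smul_eq_mul]
      ring
  refine ⟨N, ContinuousLinearMap.toPointwiseConvergenceCLM _ _ _ _
    (SchwartzMap.mkCLMtoNormedSpace (σ := RingHom.id ℂ)
    (fun u ↦ ∑' k : ℕ, a k * ((2 : ℝ) ^ ((k : ℝ) * s) : ℝ) * taylorPairing N b k u)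
    (fun u v ↦ ?_) (fun c u ↦ ?_)
    ⟨{(0, N + 1)}, 2 * (K * ∫ ξ, ‖ξ‖ ^ (N + 1) * ‖b ξ‖), by positivity, fun u ↦ ?_⟩), fun u ↦ rfl⟩
  · simp only [hadd, mul_add]
    exact (summable_lacunary hN b ha u).tsum_add (summable_lacunary hN b ha v)
  · simp only [hsmul, RingHom.id_apply, smul_eq_mul, mul_left_comm _ c]
    exact tsum_mul_left
  · refine (tsum_of_norm_bounded (hasSum_geometric_two.mul_right _)
      fun k ↦ norm_lacunary_term_le hN b ha k u).trans_eq ?_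
    rw [Finset.sup_singleton, SchwartzMap.schwartzSeminormFamily_apply]
    ring

/-! ### Functions localised in a single dyadic annulus -/

lemma Cutoff.toFun_eq_zero (χ : Cutoff d) {ξ : Rd d} (h : 2 < ‖ξ‖) : χ.toFun ξ = 0 :=
  image_eq_zero_of_notMem_tsupport fun h' ↦ by
    have := χ.tsupport_subset h'
    rw [mem_closedBall_zero_iff] at this
    linarith

lemma Cutoff.toFun_eq_one (χ : Cutoff d) {ξ : Rd d} (h : ‖ξ‖ ≤ 1) : χ.toFun ξ = 1 :=
  χ.eq_one.self_of_nhdsSet ξ (mem_closedBall_zero_iff.2 h)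

lemma Cutoff.hasCompactSupport (χ : Cutoff d) : HasCompactSupport χ.toFun :=
  HasCompactSupport.intro (isCompact_closedBall (0 : Rd d) 2) fun _ hx ↦
    image_eq_zero_of_notMem_tsupport fun h ↦ hx (χ.tsupport_subset h)

lemma Cutoff.hasTemperateGrowth_comp_smul (χ : Cutoff d) (c : ℝ) :
    (fun ξ : Rd d ↦ (χ.toFun (c • ξ) : ℂ)).HasTemperateGrowth :=
  Function.HasTemperateGrowth.comp Function.Complex.hasTemperateGrowth_ofReal
    (Function.HasTemperateGrowth.comp (χ.hasCompactSupport.hasTemperateGrowth χ.smooth)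
      (ContinuousLinearMap.hasTemperateGrowth (c • ContinuousLinearMap.id ℝ (Rd d))))

lemma two_zpow_neg_neg_smul (k : ℕ) (ξ : Rd d) :
    ((2 : ℝ) ^ (-(-(k : ℤ)))) • ξ = (2 : ℝ) ^ k • ξ := by
  rw [neg_neg, zpow_natCast]

/-- A Schwartz function supported where only the zeroth dyadic symbol is nonzero, and where this
symbol equals one. -/
def Cutoff.IsAnnular (χ : Cutoff d) (b : 𝓢(Rd d, ℂ)) : Prop :=
  ∀ ξ, b ξ ≠ 0 → 1 < ‖ξ‖ ∧ ‖ξ‖ < 2 ∧ χ.toFun ξ = 1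

/-- Since `χ = 1` on a neighbourhood of the closed unit ball, there is room for a small bump centred
at `r e` with `r` slightly larger than `1`. -/
lemma Cutoff.exists_isAnnular (χ : Cutoff d) (hd : 1 ≤ d) :
    ∃ b : 𝓢(Rd d, ℂ), χ.IsAnnular b ∧ ∫ ξ, b ξ ≠ 0 := by
  let e : Rd d := EuclideanSpace.single ⟨0, hd⟩ 1
  have he : ‖e‖ = 1 := by simp [e]
  have h1 : ∀ᶠ ξ in 𝓝 e, χ.toFun ξ = 1 :=
    χ.eq_one.filter_mono (nhds_le_nhdsSet (by simp [he]))
  have h2 : ∀ᶠ ξ in 𝓝 e, ∀ᶠ η in 𝓝 ξ, χ.toFun η = 1 ∧ ‖η‖ < 2 := by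
    refine eventually_eventually_nhds.2 (h1.and ?_)
    exact continuous_norm.continuousAt.eventually_lt_const (he.trans_lt one_lt_two)
  have h3 : Tendsto (fun r : ℝ ↦ r • e) (𝓝[>] 1) (𝓝 e) := by
    have : Continuous fun r : ℝ ↦ r • e := by fun_prop
    have h := this.tendsto 1
    rw [one_smul] at h
    exact h.mono_left nhdsWithin_le_nhds
  obtain ⟨r, hr, hr1⟩ := ((h3.eventually h2).and self_mem_nhdsWithin).exists
  have h4 : ∀ᶠ η in 𝓝 (r • e), 1 < ‖η‖ := by
    refine continuous_norm.continuousAt.eventually_const_lt ?_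
    change 1 < ‖r • e‖
    rw [norm_smul, he, mul_one, Real.norm_of_nonneg (zero_le_one.trans (le_of_lt hr1))]
    exact hr1
  obtain ⟨ρ, hρ, hball⟩ := Metric.eventually_nhds_iff_ball.1 (hr.and h4)
  let f : ContDiffBump (r • e) := ⟨ρ / 2, ρ, half_pos hρ, half_lt_self hρ⟩
  have hsm : ContDiff ℝ ∞ fun ξ : Rd d ↦ (f ξ : ℂ) := Complex.ofRealCLM.contDiff.comp f.contDiff
  have hcs : HasCompactSupport fun ξ : Rd d ↦ (f ξ : ℂ) :=
    f.hasCompactSupport.comp_left (g := Complex.ofReal) Complex.ofReal_zero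
  refine ⟨hcs.toSchwartzMap hsm, fun ξ hξ ↦ ?_, ?_⟩
  · have hξ' : ξ ∈ Function.support f := fun h ↦ hξ (by simp [h])
    rw [f.support_eq] at hξ'
    obtain ⟨⟨h5, h6⟩, h7⟩ := hball ξ hξ'
    exact ⟨h7, h6, h5⟩
  · simp only [HasCompactSupport.toSchwartzMap_toFun]
    rw [integral_complex_ofReal]
    exact Complex.ofReal_ne_zero.2 f.integral_pos.ne'

/-- With `η = 2^k ξ` in the support of `b`, the symbol is `χ(cη) - χ(2cη)` for `c = 2^{-k-m}`. If `c
= 1` it is `1 - 0`; if `c ≥ 2` both terms vanish; if `c ≤ 1/2` both equal one. The borderline `c =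
1/2` needs `χ(η) = 1`, not just `‖η‖ < 2`. -/
lemma Cutoff.IsAnnular.symbol_mul_dil {χ : Cutoff d} {b : 𝓢(Rd d, ℂ)} (hb : χ.IsAnnular b)
    (m : ℤ) (k : ℕ) (ξ : Rd d) :
    χ.symbol m ξ * dil k b ξ = if m = -(k : ℤ) then dil k b ξ else 0 := by
  rw [dil_apply]
  set η : Rd d := (2 : ℝ) ^ k • ξ with hη
  by_cases h0 : b η = 0
  · simp [h0]
  obtain ⟨h1, h2, h3⟩ := hb η h0
  have hs : χ.symbol m ξ = (χ.phi (((2 : ℝ) ^ (-(k : ℤ) - m)) • η) : ℂ) := by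
    rw [Cutoff.symbol, hη, smul_smul, ← zpow_natCast (2 : ℝ) k,
      ← zpow_add₀ (two_ne_zero' ℝ)]
    congr 4
    ring
  have hn : ∀ c : ℝ, 0 ≤ c → ‖c • η‖ = c * ‖η‖ := fun c hc ↦ by
    rw [norm_smul, Real.norm_of_nonneg hc]
  rw [hs]
  clear_value η
  split_ifs with hm
  · have : χ.toFun ((2 : ℝ) • η) = 0 :=
      χ.toFun_eq_zero (by rw [hn 2 zero_le_two]; linarith)
    simp [hm, Cutoff.phi, h3, this]
  · have : χ.phi (((2 : ℝ) ^ (-(k : ℤ) - m)) • η) = 0 := by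
      rw [Cutoff.phi, smul_smul]
      rcases lt_or_gt_of_ne (sub_ne_zero.2 (Ne.symm hm)) with h | h
      · have h4 : (2 : ℝ) ^ (-(k : ℤ) - m) ≤ 2 ^ (-1 : ℤ) :=
          zpow_le_zpow_right₀ one_le_two (by lia)
        have h4' : (0 : ℝ) < (2 : ℝ) ^ (-(k : ℤ) - m) := by positivity
        rw [zpow_neg_one] at h4
        rw [χ.toFun_eq_one (by rw [hn _ h4'.le]; nlinarith)]
        rcases eq_or_ne (-(k : ℤ) - m) (-1) with h5 | h5
        · rw [h5, zpow_neg_one, mul_inv_cancel₀ two_ne_zero, one_smul, h3, sub_self]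
        · have h6 : (2 : ℝ) ^ (-(k : ℤ) - m) ≤ 2 ^ (-2 : ℤ) :=
            zpow_le_zpow_right₀ one_le_two (by lia)
          rw [show (2 : ℝ) ^ (-2 : ℤ) = 1 / 4 by norm_num] at h6
          rw [χ.toFun_eq_one (by rw [hn _ (by positivity)]; nlinarith), sub_self]
      · have h4 : (2 : ℝ) ^ (1 : ℤ) ≤ (2 : ℝ) ^ (-(k : ℤ) - m) :=
          zpow_le_zpow_right₀ one_le_two (by lia)
        rw [zpow_one] at h4
        rw [χ.toFun_eq_zero (by rw [hn _ (by positivity)]; nlinarith),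
          χ.toFun_eq_zero (by rw [hn _ (by positivity)]; nlinarith), sub_self]
    simp [this]

lemma block_apply (χ : Cutoff d) (m : ℤ) (T : TD d) (u : 𝓢(Rd d, ℂ)) :
    block χ m T u = T (𝓕 (SchwartzMap.smulLeftCLM ℂ (χ.symbol m) (𝓕⁻ u))) := rfl

/-- The integrable function whose Fourier transform is `b (2^k ξ)`. -/
def dilLp (b : 𝓢(Rd d, ℂ)) (k : ℕ) : Lp ℂ 1 (volume : Measure (Rd d)) :=
  (𝓕⁻ (dil k b) : 𝓢(Rd d, ℂ)).toLp 1

lemma norm_dilLp (b : 𝓢(Rd d, ℂ)) (k : ℕ) : ‖dilLp b k‖ = ∫ x, ‖𝓕⁻ b x‖ := by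
  rw [dilLp, L1.norm_eq_integral_norm, ← integral_norm_fourierInv_dil k b]
  refine integral_congr_ae ?_
  filter_upwards [(𝓕⁻ (dil k b) : 𝓢(Rd d, ℂ)).coeFn_toLp 1 volume] with x hx
  rw [hx]

lemma dilLp_apply (b : 𝓢(Rd d, ℂ)) (k : ℕ) (u : 𝓢(Rd d, ℂ)) :
    Lp.toTemperedDistribution (dilLp b k) u = ∫ ξ, dil k b ξ * 𝓕⁻ u ξ := by
  rw [dilLp, Lp.toTemperedDistribution_toLp_eq, ← SchwartzMap.integral_fourierInv_mul_eq]
  refine (SchwartzMap.toTemperedDistributionCLM_apply_apply volume _ _).trans ?_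
  simp only [smul_eq_mul, mul_comm]

lemma Cutoff.IsAnnular.integral_dil_mul_symbol_mul {χ : Cutoff d} {b : 𝓢(Rd d, ℂ)}
    (hb : χ.IsAnnular b) (m : ℤ) (k : ℕ) (u : 𝓢(Rd d, ℂ)) :
    ∫ ξ, dil k b ξ * SchwartzMap.smulLeftCLM ℂ (χ.symbol m) (𝓕⁻ u) ξ =
      if m = -(k : ℤ) then Lp.toTemperedDistribution (dilLp b k) u else 0 := by
  have h : ∀ ξ, dil k b ξ * SchwartzMap.smulLeftCLM ℂ (χ.symbol m) (𝓕⁻ u) ξ =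
      (if m = -(k : ℤ) then dil k b ξ else 0) * 𝓕⁻ u ξ := fun ξ ↦ by
    rw [SchwartzMap.smulLeftCLM_apply_apply (χ.hasTemperateGrowth_symbol m), smul_eq_mul,
      ← hb.symbol_mul_dil]
    ring
  simp only [h]
  split_ifs
  · exact (dilLp_apply b k u).symm
  · simp

lemma Cutoff.IsAnnular.block_dilLp {χ : Cutoff d} {b : 𝓢(Rd d, ℂ)} (hb : χ.IsAnnular b) (m : ℤ)
    (k : ℕ) : block χ m (Lp.toTemperedDistribution (dilLp b k)) =
      if m = -(k : ℤ) then Lp.toTemperedDistribution (dilLp b k) else 0 := by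
  ext u
  rw [block_apply, dilLp_apply, FourierTransform.fourierInv_fourier_eq,
    hb.integral_dil_mul_symbol_mul]
  split_ifs <;> rfl

/-- The spectrum lies in `‖ξ‖ > 2^{-k}`, so `χ(t ξ)` vanishes on it once `t > 2^{k+1}`. -/
lemma Cutoff.IsAnnular.dilLp_mem_sPrimeH {χ : Cutoff d} {b : 𝓢(Rd d, ℂ)} (hb : χ.IsAnnular b)
    (k : ℕ) : Lp.toTemperedDistribution (dilLp b k) ∈ sPrimeH χ := by
  refine tendsto_const_nhds.congr' ?_
  filter_upwards [eventually_gt_atTop ((2 : ℝ) ^ (k + 1))] with t ht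
  ext u
  rw [TemperedDistribution.smulLeftCLM_apply_apply, TemperedDistribution.fourier_apply,
    dilLp_apply, FourierTransform.fourierInv_fourier_eq]
  symm
  refine (integral_congr_ae (Eventually.of_forall fun ξ ↦ ?_)).trans (integral_zero _ _)
  rw [SchwartzMap.smulLeftCLM_apply_apply (χ.hasTemperateGrowth_comp_smul t)]
  by_cases h0 : dil k b ξ = 0
  · simp [h0]
  have h1 : 1 < ‖(2 : ℝ) ^ k • ξ‖ := (hb _ h0).1
  rw [norm_smul, Real.norm_of_nonneg (by positivity)] at h1
  have ht0 : 0 < t := lt_trans (by positivity) ht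
  have h2 : 2 < ‖t • ξ‖ := by
    rw [norm_smul, Real.norm_of_nonneg ht0.le]
    rw [pow_succ] at ht
    have : 0 ≤ ‖ξ‖ := norm_nonneg ξ
    nlinarith
  simp [χ.toFun_eq_zero h2]

/-- A tempered distribution with prescribed multiples of `dilLp b k` as dyadic blocks. -/
theorem Cutoff.IsAnnular.exists_block_eq {χ : Cutoff d} {b : 𝓢(Rd d, ℂ)} (hb : χ.IsAnnular b)
    (s : ℝ) {a : ℕ → ℂ} {K : ℝ} (ha : ∀ k, ‖a k‖ ≤ K) : ∃ T : TD d,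
      (∀ k : ℕ, block χ (-(k : ℤ)) T =
        Lp.toTemperedDistribution ((a k * ((2 : ℝ) ^ ((k : ℝ) * s) : ℝ)) • dilLp b k)) ∧
      ∀ m : ℤ, 0 < m → block χ m T = 0 := by
  obtain ⟨N, S, hS⟩ := exists_lacunary_distribution s b ha
  have hblock : ∀ m u, block χ m (𝓕⁻ S) u = ∑' k : ℕ, a k * ((2 : ℝ) ^ ((k : ℝ) * s) : ℝ) *
      if m = -(k : ℤ) then Lp.toTemperedDistribution (dilLp b k) u else 0 := by
    intro m u
    rw [block_apply, TemperedDistribution.fourierInv_apply,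
      FourierTransform.fourierInv_fourier_eq, hS]
    congr 1
    funext k
    rw [← hb.integral_dil_mul_symbol_mul, taylorPairing]
    congr 2
    funext ξ
    -- The symbol of a block vanishes near the origin, so the renormalisation disappears on the test
    -- functions that a block produces.
    rw [taylorZero_eq_zero, sub_zero]
    filter_upwards [χ.symbol_eventually_eq_zero m] with η hη
    rw [SchwartzMap.smulLeftCLM_apply_apply (χ.hasTemperateGrowth_symbol m), hη, zero_smul]
  refine ⟨𝓕⁻ S, fun k ↦ ?_, fun m hm ↦ ?_⟩
  · ext u
    rw [hblock, tsum_eq_single k fun j hj ↦ by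
      rw [if_neg (by simpa using Ne.symm hj), mul_zero], if_pos rfl]
    exact congrArg (fun T : TD d ↦ T u) ((Lp.toTemperedDistributionCLM ℂ volume 1).map_smul
      (a k * ((2 : ℝ) ^ ((k : ℝ) * s) : ℝ)) (dilLp b k)).symm
  · ext u
    rw [hblock]
    exact (tsum_congr fun k ↦ by rw [if_neg (by lia), mul_zero]).trans tsum_zero

/-! ### Dyadic blocks as integrable functions -/

lemma injective_toTemperedDistribution :
    Function.Injective (Lp.toTemperedDistributionCLM ℂ (volume : Measure (Rd d)) 1) :=
  LinearMap.ker_eq_bot.1 Lp.ker_toTemperedDistributionCLM_eq_bot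

section

variable (χ : Cutoff d) (s : ℝ)

/-- Otherwise the infimum defining `lpENorm` is over an empty set, hence infinite, and the positive
weight makes the Besov norm infinite. -/
lemma exists_blockLp (m : ℤ) (f : Besov χ s 1) : ∃ g : Lp ℂ 1 (volume : Measure (Rd d)),
    Lp.toTemperedDistributionCLM ℂ volume 1 g = blockQ χ m (Besov.incl χ s 1 f) := by
  by_contra! h
  have h1 : lpENorm 1 (blockQ χ m (Besov.incl χ s 1 f)) = ⊤ :=
    iInf_eq_top.2 fun g ↦ iInf_eq_top.2 fun hg ↦ absurd hg (h g)
  have h2 : ENNReal.ofReal ((2 : ℝ) ^ ((m : ℝ) * s)) *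
      lpENorm 1 (blockQ χ m (Besov.incl χ s 1 f)) ≤ besovENorm χ s 1 (Besov.incl χ s 1 f) :=
    le_iSup (fun m : ℤ ↦ ENNReal.ofReal ((2 : ℝ) ^ ((m : ℝ) * s)) *
      lpENorm 1 (blockQ χ m (Besov.incl χ s 1 f))) m
  rw [h1, ENNReal.mul_top (by simpa using Real.rpow_pos_of_pos two_pos _), top_le_iff] at h2
  exact Besov.enorm_ne_top χ s 1 f h2

/-- The dyadic block of an element of the Besov space, as a linear map into `L¹`. -/
def blockLpₗ (m : ℤ) : Besov χ s 1 →ₗ[ℂ] Lp ℂ 1 (volume : Measure (Rd d)) where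
  toFun f := (exists_blockLp χ s m f).choose
  map_add' f g := injective_toTemperedDistribution <| by
    refine (exists_blockLp χ s m (f + g)).choose_spec.trans ?_
    rw [map_add, map_add, map_add, (exists_blockLp χ s m f).choose_spec,
      (exists_blockLp χ s m g).choose_spec]
  map_smul' c f := injective_toTemperedDistribution <| by
    refine (exists_blockLp χ s m (c • f)).choose_spec.trans ?_
    rw [RingHom.id_apply, map_smul, map_smul, map_smul, (exists_blockLp χ s m f).choose_spec]

lemma toTemperedDistribution_blockLpₗ (m : ℤ) (f : Besov χ s 1) :
    Lp.toTemperedDistribution (blockLpₗ χ s m f) = blockQ χ m (Besov.incl χ s 1 f) :=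
  (exists_blockLp χ s m f).choose_spec

lemma besovENorm_incl (f : Besov χ s 1) : besovENorm χ s 1 (Besov.incl χ s 1 f) =
    ⨆ m : ℤ, ENNReal.ofReal ((2 : ℝ) ^ ((m : ℝ) * s) * ‖blockLpₗ χ s m f‖) := by
  refine iSup_congr fun m ↦ ?_
  rw [← toTemperedDistribution_blockLpₗ, lpENorm_coe, ENNReal.ofReal_mul (by positivity),
    ofReal_norm]

lemma norm_blockLpₗ_le (m : ℤ) (f : Besov χ s 1) :
    (2 : ℝ) ^ ((m : ℝ) * s) * ‖blockLpₗ χ s m f‖ ≤ ‖f‖ := by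
  rw [Besov.norm_def, ← ENNReal.ofReal_le_iff_le_toReal (Besov.enorm_ne_top χ s 1 f),
    besovENorm_incl]
  exact le_iSup (fun m : ℤ ↦ ENNReal.ofReal ((2 : ℝ) ^ ((m : ℝ) * s) * ‖blockLpₗ χ s m f‖)) m

lemma Besov.norm_le_of_block {f : Besov χ s 1} {K : ℝ}
    (h : ∀ m : ℤ, (2 : ℝ) ^ ((m : ℝ) * s) * ‖blockLpₗ χ s m f‖ ≤ K) : ‖f‖ ≤ K := by
  have hK : 0 ≤ K := le_trans (by positivity) (h 0)
  rw [Besov.norm_def, besovENorm_incl]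
  exact ENNReal.toReal_le_of_le_ofReal hK (iSup_le fun m ↦ ENNReal.ofReal_le_ofReal (h m))

/-- The dyadic block of an element of the Besov space, as a continuous linear map into `L¹`. -/
def blockLp (m : ℤ) : Besov χ s 1 →L[ℂ] Lp ℂ 1 (volume : Measure (Rd d)) :=
  (blockLpₗ χ s m).mkContinuous ((2 : ℝ) ^ ((m : ℝ) * s))⁻¹ fun f ↦ by
    rw [le_inv_mul_iff₀ (by positivity)]
    exact norm_blockLpₗ_le χ s m f

lemma exists_besov_of_block {T : TD d} {g : ℤ → Lp ℂ 1 (volume : Measure (Rd d))} {K : ℝ}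
    (hg : ∀ m, block χ m T = Lp.toTemperedDistribution (g m))
    (hK : ∀ m : ℤ, (2 : ℝ) ^ ((m : ℝ) * s) * ‖g m‖ ≤ K) :
    ∃ f : Besov χ s 1, Besov.incl χ s 1 f = (polys d).mkQ T ∧ ∀ m, blockLpₗ χ s m f = g m := by
  have hQ : ∀ m, blockQ χ m ((polys d).mkQ T) = Lp.toTemperedDistribution (g m) := hg
  have h : besovENorm χ s 1 ((polys d).mkQ T) < ⊤ := by
    refine lt_of_le_of_lt (iSup_le fun m ↦ ?_) (ENNReal.ofReal_lt_top (r := K))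
    rw [hQ, lpENorm_coe, ← ofReal_norm, ← ENNReal.ofReal_mul (by positivity)]
    exact ENNReal.ofReal_le_ofReal (hK m)
  refine ⟨⟨(polys d).mkQ T, h⟩, rfl, fun m ↦ injective_toTemperedDistribution ?_⟩
  exact (toTemperedDistribution_blockLpₗ χ s m _).trans (hQ m)

end

variable {χ : Cutoff d} {b : 𝓢(Rd d, ℂ)}

/-! ### Lacunary series in the Besov space -/

lemma two_rpow_neg_mul_cancel (s : ℝ) (k : ℕ) :
    (2 : ℝ) ^ (((-(k : ℤ) : ℤ) : ℝ) * s) * (2 : ℝ) ^ ((k : ℝ) * s) = 1 := by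
  rw [← Real.rpow_add two_pos]
  simp

/-- The element `f` of the Besov space is the lacunary series with coefficients `a`. -/
def IsLacunary (b : 𝓢(Rd d, ℂ)) (s : ℝ) (a : ℕ → ℂ) (f : Besov χ s 1) : Prop :=
  (∀ k : ℕ, blockLpₗ χ s (-(k : ℤ)) f = (a k * ((2 : ℝ) ^ ((k : ℝ) * s) : ℝ)) • dilLp b k) ∧
    ∀ m : ℤ, 0 < m → blockLpₗ χ s m f = 0

lemma IsLacunary.sub {s : ℝ} {a a' : ℕ → ℂ} {f f' : Besov χ s 1} (h : IsLacunary b s a f)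
    (h' : IsLacunary b s a' f') : IsLacunary b s (fun k ↦ a k - a' k) (f - f') :=
  ⟨fun k ↦ by rw [map_sub, h.1, h'.1, sub_mul, sub_smul],
    fun m hm ↦ by rw [map_sub, h.2 m hm, h'.2 m hm, sub_zero]⟩

lemma IsLacunary.sum_smul {s : ℝ} {ι : Type*} {a : ι → ℕ → ℂ} {f : ι → Besov χ s 1} (F : Finset ι)
    (c : ι → ℂ) (h : ∀ i ∈ F, IsLacunary b s (a i) (f i)) :
    IsLacunary b s (fun k ↦ ∑ i ∈ F, c i * a i k) (∑ i ∈ F, c i • f i) := by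
  refine ⟨fun k ↦ ?_, fun m hm ↦ ?_⟩
  · rw [map_sum, Finset.sum_mul, Finset.sum_smul]
    exact Finset.sum_congr rfl fun i hi ↦ by rw [map_smul, (h i hi).1, smul_smul, mul_assoc]
  · rw [map_sum]
    exact Finset.sum_eq_zero fun i hi ↦ by rw [map_smul, (h i hi).2 m hm, smul_zero]

lemma two_rpow_mul_norm_smul_dilLp (s : ℝ) (c : ℂ) (k : ℕ) :
    (2 : ℝ) ^ (((-(k : ℤ) : ℤ) : ℝ) * s) * ‖(c * ((2 : ℝ) ^ ((k : ℝ) * s) : ℝ)) • dilLp b k‖ =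
      ‖c‖ * ∫ x, ‖𝓕⁻ b x‖ := by
  rw [norm_smul, norm_mul, norm_dilLp, Complex.norm_real, Real.norm_of_nonneg (by positivity),
    ← mul_assoc, mul_left_comm, two_rpow_neg_mul_cancel, mul_one]

lemma IsLacunary.norm_le {s : ℝ} {a : ℕ → ℂ} {f : Besov χ s 1} (h : IsLacunary b s a f)
    {K : ℝ} (ha : ∀ k, ‖a k‖ ≤ K) : ‖f‖ ≤ K * ∫ x, ‖𝓕⁻ b x‖ := by
  have hB : 0 ≤ ∫ x, ‖𝓕⁻ b x‖ := integral_nonneg fun x ↦ norm_nonneg _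
  refine Besov.norm_le_of_block χ s fun m ↦ ?_
  rcases lt_or_ge 0 m with hm | hm
  · rw [h.2 m hm, norm_zero, mul_zero]
    exact mul_nonneg ((norm_nonneg _).trans (ha 0)) hB
  · obtain ⟨k, rfl⟩ := Int.exists_eq_neg_ofNat hm
    rw [h.1, two_rpow_mul_norm_smul_dilLp]
    exact mul_le_mul_of_nonneg_right (ha k) hB

lemma Cutoff.IsAnnular.exists_isLacunary (hb : χ.IsAnnular b) (s : ℝ) {a : ℕ → ℂ} {K : ℝ}
    (ha : ∀ k, ‖a k‖ ≤ K) : ∃ f : Besov χ s 1, IsLacunary b s a f := by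
  obtain ⟨T, hT, hT'⟩ := hb.exists_block_eq s ha
  have hB : 0 ≤ ∫ x, ‖𝓕⁻ b x‖ := integral_nonneg fun x ↦ norm_nonneg _
  let g : ℤ → Lp ℂ 1 (volume : Measure (Rd d)) := fun m ↦ if 0 < m then 0 else
    (a m.natAbs * ((2 : ℝ) ^ ((m.natAbs : ℝ) * s) : ℝ)) • dilLp b m.natAbs
  have hg0 : ∀ m, 0 < m → g m = 0 := fun m hm ↦ if_pos hm
  have hg : ∀ k : ℕ, g (-(k : ℤ)) = (a k * ((2 : ℝ) ^ ((k : ℝ) * s) : ℝ)) • dilLp b k :=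
    fun k ↦ by simp [g]
  have hblock : ∀ m, block χ m T = Lp.toTemperedDistribution (g m) := fun m ↦ by
    rcases lt_or_ge 0 m with hm | hm
    · rw [hT' m hm, hg0 m hm]
      exact ((Lp.toTemperedDistributionCLM ℂ volume 1).map_zero).symm
    · obtain ⟨k, rfl⟩ := Int.exists_eq_neg_ofNat hm
      rw [hT, hg]
  have hnorm : ∀ m : ℤ, (2 : ℝ) ^ ((m : ℝ) * s) * ‖g m‖ ≤ K * ∫ x, ‖𝓕⁻ b x‖ := fun m ↦ by
    rcases lt_or_ge 0 m with hm | hm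
    · rw [hg0 m hm, norm_zero, mul_zero]
      exact mul_nonneg ((norm_nonneg _).trans (ha 0)) hB
    · obtain ⟨k, rfl⟩ := Int.exists_eq_neg_ofNat hm
      rw [hg, two_rpow_mul_norm_smul_dilLp]
      exact mul_le_mul_of_nonneg_right (ha k) hB
  obtain ⟨f, -, hf⟩ := exists_besov_of_block χ s hblock hnorm
  exact ⟨f, fun k ↦ by rw [hf, hg], fun m hm ↦ by rw [hf, hg0 m hm]⟩

lemma Cutoff.IsAnnular.exists_single_mem_closureC (hb : χ.IsAnnular b) (s : ℝ) (k : ℕ) :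
    ∃ e ∈ closureC χ s 1, IsLacunary b s (fun j ↦ if j = k then 1 else 0) e := by
  let g : ℤ → Lp ℂ 1 (volume : Measure (Rd d)) := fun m ↦ if m = -(k : ℤ) then dilLp b k else 0
  have hblock : ∀ m, block χ m (Lp.toTemperedDistribution (dilLp b k)) =
      Lp.toTemperedDistribution (g m) := fun m ↦ by
    rw [hb.block_dilLp]
    by_cases hm : m = -(k : ℤ)
    · simp only [g, if_pos hm]
    · simp only [g, if_neg hm]
      exact ((Lp.toTemperedDistributionCLM ℂ volume 1).map_zero).symm
  have hnorm : ∀ m : ℤ, (2 : ℝ) ^ ((m : ℝ) * s) * ‖g m‖ ≤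
      (2 : ℝ) ^ (((-(k : ℤ) : ℤ) : ℝ) * s) * ‖dilLp b k‖ := fun m ↦ by
    by_cases hm : m = -(k : ℤ)
    · simp only [g, hm, if_true, le_refl]
    · simp only [g, if_neg hm, norm_zero, mul_zero]
      positivity
  obtain ⟨f, hf, hfb⟩ := exists_besov_of_block χ s hblock hnorm
  have hfC : f ∈ closureC χ s 1 :=
    Submodule.le_topologicalClosure _ ⟨_, hb.dilLp_mem_sPrimeH k, hf.symm⟩
  refine ⟨(((2 : ℝ) ^ ((k : ℝ) * s) : ℝ) : ℂ) • f, (closureC χ s 1).smul_mem _ hfC,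
    fun j ↦ ?_, fun m hm ↦ ?_⟩
  · rw [map_smul, hfb]
    by_cases hj : j = k
    · simp [g, hj]
    · simp [g, hj]
  · rw [map_smul, hfb]
    simp only [g]
    rw [if_neg (by lia), smul_zero]

lemma Cutoff.IsAnnular.exists_truncation_mem_closureC (hb : χ.IsAnnular b) (s : ℝ) (a : ℕ → ℂ)
    (n : ℕ) : ∃ h ∈ closureC χ s 1, IsLacunary b s (fun k ↦ if k < n then a k else 0) h := by
  choose e he hel using hb.exists_single_mem_closureC s
  refine ⟨∑ j ∈ Finset.range n, a j • e j,
    Submodule.sum_mem _ fun j _ ↦ Submodule.smul_mem _ _ (he j), ?_⟩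
  have h := IsLacunary.sum_smul (Finset.range n) a fun j _ ↦ hel j
  simpa using h

/-! ### A sequence of functionals characterising low frequencies -/

/-- The Schwartz function `χ(ξ / 2)`. -/
def Cutoff.wide (χ : Cutoff d) : 𝓢(Rd d, ℂ) :=
  HasCompactSupport.toSchwartzMap (f := fun ξ : Rd d ↦ (χ.toFun ((2 : ℝ)⁻¹ • ξ) : ℂ))
    ((χ.hasCompactSupport.comp_smul (inv_ne_zero two_ne_zero)).comp_left
      (g := Complex.ofReal) Complex.ofReal_zero)
    (Complex.ofRealCLM.contDiff.comp (χ.smooth.comp (contDiff_const_smul _)))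

lemma Cutoff.wide_eq_one (χ : Cutoff d) {ξ : Rd d} (h : ‖ξ‖ ≤ 2) : χ.wide ξ = 1 := by
  change (χ.toFun ((2 : ℝ)⁻¹ • ξ) : ℂ) = 1
  rw [χ.toFun_eq_one, Complex.ofReal_one]
  rw [norm_smul, norm_inv, Real.norm_of_nonneg zero_le_two]
  linarith

lemma Cutoff.symbol_neg_apply (χ : Cutoff d) (k : ℕ) (ξ : Rd d) :
    χ.symbol (-(k : ℤ)) ξ =
      (χ.toFun ((2 : ℝ) ^ k • ξ) : ℂ) - (χ.toFun ((2 : ℝ) ^ (k + 1) • ξ) : ℂ) := by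
  rw [Cutoff.symbol, Cutoff.phi, two_zpow_neg_neg_smul, smul_smul, pow_succ',
    Complex.ofReal_sub]

/-- Both `χ.wide` and its dilation equal one where the symbol is nonzero. This trades a test
function depending on `k` for a fixed one, as convergence in `𝓢'` requires. -/
lemma Cutoff.symbol_smul_dil_wide (χ : Cutoff d) (k : ℕ) :
    SchwartzMap.smulLeftCLM ℂ (χ.symbol (-(k : ℤ))) (dil k χ.wide) =
      SchwartzMap.smulLeftCLM ℂ (χ.symbol (-(k : ℤ))) χ.wide := by
  ext ξ
  rw [SchwartzMap.smulLeftCLM_apply_apply (χ.hasTemperateGrowth_symbol _),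
    SchwartzMap.smulLeftCLM_apply_apply (χ.hasTemperateGrowth_symbol _)]
  have hk : (1 : ℝ) ≤ 2 ^ k := one_le_pow₀ one_le_two
  have hn : ‖(2 : ℝ) ^ k • ξ‖ = 2 ^ k * ‖ξ‖ := by
    rw [norm_smul, Real.norm_of_nonneg (by positivity)]
  rcases le_or_gt (‖(2 : ℝ) ^ k • ξ‖) 2 with h | h
  · rw [dil_apply, χ.wide_eq_one h, χ.wide_eq_one]
    rw [hn] at h
    nlinarith [norm_nonneg ξ]
  · have h' : 2 < ‖(2 : ℝ) ^ (k + 1) • ξ‖ := by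
      rw [pow_succ', mul_smul, norm_smul, Real.norm_of_nonneg zero_le_two]
      linarith
    rw [χ.symbol_neg_apply, χ.toFun_eq_zero h, χ.toFun_eq_zero h']
    simp

/-- The value at the origin of the dyadic block of index `-k`, suitably normalised. -/
def lowFreq (χ : Cutoff d) (s : ℝ) (k : ℕ) : Besov χ s 1 →ₗ[ℂ] ℂ :=
  (((2 : ℝ) ^ ((k : ℝ) * (d - s)) : ℝ) : ℂ) •
    { toFun := fun f ↦ Lp.toTemperedDistribution (blockLpₗ χ s (-(k : ℤ)) f) (𝓕 (dil k χ.wide))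
      map_add' := fun f g ↦ by
        rw [map_add]
        exact congrArg (fun T : TD d ↦ T (𝓕 (dil k χ.wide)))
          ((Lp.toTemperedDistributionCLM ℂ volume 1).map_add _ _)
      map_smul' := fun c f ↦ by
        rw [map_smul]
        exact congrArg (fun T : TD d ↦ T (𝓕 (dil k χ.wide)))
          ((Lp.toTemperedDistributionCLM ℂ volume 1).map_smul c _) }

lemma lowFreq_apply (s : ℝ) (k : ℕ) (f : Besov χ s 1) :
    lowFreq χ s k f = ((2 : ℝ) ^ ((k : ℝ) * (d - s)) : ℝ) *
      Lp.toTemperedDistribution (blockLpₗ χ s (-(k : ℤ)) f) (𝓕 (dil k χ.wide)) := rfl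

lemma norm_toTemperedDistribution_apply_le (g : Lp ℂ 1 (volume : Measure (Rd d)))
    {u : 𝓢(Rd d, ℂ)} {K : ℝ} (hu : ∀ x, ‖u x‖ ≤ K) :
    ‖Lp.toTemperedDistribution g u‖ ≤ K * ‖g‖ := by
  rw [Lp.toTemperedDistribution_apply, L1.norm_eq_integral_norm, ← integral_const_mul]
  refine norm_integral_le_of_norm_le ((L1.integrable_coeFn g).norm.const_mul K)
    (Eventually.of_forall fun x ↦ ?_)
  rw [norm_smul]
  exact mul_le_mul_of_nonneg_right (hu x) (norm_nonneg _)

/-- The sup norm of `𝓕 (dil k χ.wide)` is at most `2^{-kd} ∫ ‖χ.wide‖`. The normalisation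
`2^{k(d-s)}` turns `2^{-kd}` into the Besov weight `2^{-ks}`, whence a bound independent of `k`. -/
lemma norm_lowFreq_le (s : ℝ) (k : ℕ) (f : Besov χ s 1) :
    ‖lowFreq χ s k f‖ ≤ (∫ ξ, ‖χ.wide ξ‖) * ‖f‖ := by
  have h1 : ∀ x, ‖𝓕 (dil k χ.wide) x‖ ≤ ((2 : ℝ) ^ (k * d))⁻¹ * ∫ ξ, ‖χ.wide ξ‖ := by
    intro x
    rw [SchwartzMap.fourier_coe, ← smul_eq_mul, ← integral_comp_two_pow_smul k fun ξ ↦ ‖χ.wide ξ‖]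
    exact VectorFourier.norm_fourierIntegral_le_integral_norm _ _ _ _ _
  have h2 := norm_toTemperedDistribution_apply_le (blockLpₗ χ s (-(k : ℤ)) f) h1
  have h3 := norm_blockLpₗ_le χ s (-(k : ℤ)) f
  have h4 : (2 : ℝ) ^ ((k : ℝ) * (d - s)) * ((2 : ℝ) ^ (k * d))⁻¹ =
      2 ^ (((-(k : ℤ) : ℤ) : ℝ) * s) := by
    rw [← Real.rpow_natCast, ← Real.rpow_neg zero_le_two, ← Real.rpow_add two_pos]
    congr 1
    push_cast
    ring
  have hW : 0 ≤ ∫ ξ, ‖χ.wide ξ‖ := integral_nonneg fun x ↦ norm_nonneg _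
  rw [lowFreq_apply, norm_mul, Complex.norm_real, Real.norm_of_nonneg (by positivity)]
  calc _ ≤ (2 : ℝ) ^ ((k : ℝ) * (d - s)) * (((2 : ℝ) ^ (k * d))⁻¹ * (∫ ξ, ‖χ.wide ξ‖) *
        ‖blockLpₗ χ s (-(k : ℤ)) f‖) := by gcongr
    _ = (∫ ξ, ‖χ.wide ξ‖) * (2 ^ (((-(k : ℤ) : ℤ) : ℝ) * s) *
        ‖blockLpₗ χ s (-(k : ℤ)) f‖) := by rw [← h4]; ring
    _ ≤ _ := by gcongr

/-- The symbol of index `-k` is `χ(2^k ξ) - χ(2^{k+1} ξ)`, and each of the two terms tends to zero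
against `χ.wide` by definition of `𝓢'_h`. -/
lemma tendsto_block_apply_of_mem_sPrimeH {g : TD d} (hg : g ∈ sPrimeH χ) :
    Tendsto (fun k : ℕ ↦ block χ (-(k : ℤ)) g (𝓕 (dil k χ.wide))) atTop (𝓝 0) := by
  have h1 : Tendsto (fun t : ℝ ↦ 𝓕 g (SchwartzMap.smulLeftCLM ℂ
      (fun ξ : Rd d ↦ (χ.toFun (t • ξ) : ℂ)) χ.wide)) atTop (𝓝 0) :=
    PointwiseConvergenceCLM.tendsto_iff_forall_tendsto.1 hg χ.wide
  have hp : Tendsto (fun k : ℕ ↦ (2 : ℝ) ^ k) atTop atTop :=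
    tendsto_pow_atTop_atTop_of_one_lt one_lt_two
  have h2 := (h1.comp hp).sub (h1.comp (hp.comp (tendsto_add_atTop_nat 1)))
  rw [sub_zero] at h2
  refine h2.congr fun k ↦ ?_
  rw [block_apply, FourierTransform.fourierInv_fourier_eq, χ.symbol_smul_dil_wide,
    ← TemperedDistribution.fourier_apply]
  simp only [Function.comp_apply]
  rw [← map_sub]
  congr 1
  ext ξ
  rw [sub_apply, SchwartzMap.smulLeftCLM_apply_apply (χ.hasTemperateGrowth_comp_smul _),
    SchwartzMap.smulLeftCLM_apply_apply (χ.hasTemperateGrowth_comp_smul _),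
    SchwartzMap.smulLeftCLM_apply_apply (χ.hasTemperateGrowth_symbol _), ← sub_smul,
    χ.symbol_neg_apply]

lemma tendsto_lowFreq_of_mem_closureC {s : ℝ} (hs : (d : ℝ) ≤ s) {f : Besov χ s 1}
    (hf : f ∈ closureC χ s 1) : Tendsto (fun k ↦ lowFreq χ s k f) atTop (𝓝 0) := by
  have hinter : ∀ g ∈ sPrimeHInter χ s 1, Tendsto (fun k ↦ lowFreq χ s k g) atTop (𝓝 0) := by
    rintro g ⟨T, hT, hTg⟩
    have h := tendsto_block_apply_of_mem_sPrimeH hT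
    refine squeeze_zero_norm (fun k ↦ ?_) (tendsto_zero_iff_norm_tendsto_zero.1 h)
    have h1 : Lp.toTemperedDistribution (blockLpₗ χ s (-(k : ℤ)) g) = block χ (-(k : ℤ)) T := by
      rw [toTemperedDistribution_blockLpₗ, ← hTg]
      rfl
    -- This is where `s ≥ d` enters: the normalising factor does not spoil the decay.
    have h2 : (2 : ℝ) ^ ((k : ℝ) * (d - s)) ≤ 1 :=
      Real.rpow_le_one_of_one_le_of_nonpos one_le_two
        (mul_nonpos_of_nonneg_of_nonpos k.cast_nonneg (sub_nonpos.2 hs))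
    rw [lowFreq_apply, h1, norm_mul, Complex.norm_real, Real.norm_of_nonneg (by positivity)]
    exact mul_le_of_le_one_left (norm_nonneg _) h2
  have hW : 0 ≤ ∫ ξ, ‖χ.wide ξ‖ := integral_nonneg fun x ↦ norm_nonneg _
  refine Metric.tendsto_atTop.2 fun ε hε ↦ ?_
  obtain ⟨g, hg, hfg⟩ := Metric.mem_closure_iff.1 (show f ∈ closure (sPrimeHInter χ s 1 :
    Set (Besov χ s 1)) from hf) (ε / 2 / ((∫ ξ, ‖χ.wide ξ‖) + 1)) (by positivity)
  obtain ⟨n, hn⟩ := Metric.tendsto_atTop.1 (hinter g hg) (ε / 2) (half_pos hε)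
  refine ⟨n, fun k hk ↦ ?_⟩
  have h1 := hn k hk
  rw [dist_zero_right] at h1 ⊢
  have h2 : ‖lowFreq χ s k (f - g)‖ ≤ ε / 2 := by
    refine (norm_lowFreq_le s k (f - g)).trans ?_
    rw [dist_eq_norm, lt_div_iff₀ (by positivity)] at hfg
    nlinarith [norm_nonneg (f - g)]
  calc _ = ‖lowFreq χ s k (f - g) + lowFreq χ s k g‖ := by rw [map_sub, sub_add_cancel]
    _ ≤ _ := norm_add_le _ _
    _ < ε / 2 + ε / 2 := add_lt_add_of_le_of_lt h2 h1
    _ = ε := add_halves ε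

/-! ### Conclusion -/

lemma lowFreq_of_isLacunary (hb : χ.IsAnnular b) {s : ℝ} {a : ℕ → ℂ} {f : Besov χ s 1}
    (hf : IsLacunary b s a f) (k : ℕ) : lowFreq χ s k f = a k * ∫ ξ, b ξ := by
  have h1 : Lp.toTemperedDistribution (dilLp b k) (𝓕 (dil k χ.wide)) =
      (((2 : ℝ) ^ (k * d))⁻¹ : ℝ) * ∫ ξ, b ξ := by
    have h2 : ∀ ξ, dil k b ξ * dil k χ.wide ξ = b ((2 : ℝ) ^ k • ξ) := fun ξ ↦ by
      rw [dil_apply, dil_apply]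
      by_cases h0 : b ((2 : ℝ) ^ k • ξ) = 0
      · rw [h0, zero_mul]
      · rw [χ.wide_eq_one (hb _ h0).2.1.le, mul_one]
    rw [dilLp_apply, FourierTransform.fourierInv_fourier_eq]
    simp only [h2]
    rw [integral_comp_two_pow_smul, Complex.real_smul]
  have h3 : (2 : ℝ) ^ ((k : ℝ) * (d - s)) * ((2 : ℝ) ^ ((k : ℝ) * s) * ((2 : ℝ) ^ (k * d))⁻¹) =
      1 := by
    rw [← Real.rpow_natCast, ← Real.rpow_neg zero_le_two, ← Real.rpow_add two_pos,
      ← Real.rpow_add two_pos, ← Real.rpow_zero 2]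
    congr 1
    push_cast
    ring
  have h4 : Lp.toTemperedDistribution ((a k * ((2 : ℝ) ^ ((k : ℝ) * s) : ℝ)) • dilLp b k)
      (𝓕 (dil k χ.wide)) = (a k * ((2 : ℝ) ^ ((k : ℝ) * s) : ℝ)) *
        Lp.toTemperedDistribution (dilLp b k) (𝓕 (dil k χ.wide)) :=
    congrArg (fun T : TD d ↦ T (𝓕 (dil k χ.wide)))
      ((Lp.toTemperedDistributionCLM ℂ volume 1).map_smul _ (dilLp b k))
  rw [lowFreq_apply, hf.1, h4, h1]
  calc _ = a k * (((2 : ℝ) ^ ((k : ℝ) * (d - s)) * ((2 : ℝ) ^ ((k : ℝ) * s) *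
        ((2 : ℝ) ^ (k * d))⁻¹) : ℝ) : ℂ) * ∫ ξ, b ξ := by
        push_cast
        ring
    _ = _ := by rw [h3, Complex.ofReal_one, mul_one]

lemma exists_functionals_separating (χ : Cutoff d) (s : ℝ) :
    ∃ Λ : ℤ × ℕ → Besov χ s 1 →L[ℂ] ℂ, ∀ f, (∀ j, Λ j f = 0) → ‖f‖ = 0 := by
  have : Fact ((1 : ℝ≥0∞) ≠ ⊤) := ⟨ENNReal.one_ne_top⟩
  obtain ⟨Λ, hΛ⟩ := exists_seq_functional_separating (Lp ℂ 1 (volume : Measure (Rd d)))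
  refine ⟨fun j ↦ (Λ j.2).comp (blockLp χ s j.1), fun f hf ↦ ?_⟩
  refine le_antisymm (Besov.norm_le_of_block χ s fun m ↦ ?_) (norm_nonneg f)
  have h : blockLpₗ χ s m f = 0 := hΛ _ fun n ↦ hf (m, n)
  rw [h, norm_zero, mul_zero]

lemma exists_forall_ge_at_most_one {ι : Type*} {A : ι → Set ℕ}
    (hA : ∀ i j, i ≠ j → (A i ∩ A j).Finite) (F : Finset ι) :
    ∃ n, ∀ k, n ≤ k → ∀ i ∈ F, ∀ j ∈ F, k ∈ A i → k ∈ A j → i = j := by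
  classical
  have hfin : (⋃ p ∈ F ×ˢ F, if p.1 = p.2 then ∅ else A p.1 ∩ A p.2).Finite := by
    refine (Finset.finite_toSet _).biUnion fun p _ ↦ ?_
    split_ifs with h
    · exact Set.finite_empty
    · exact hA _ _ h
  obtain ⟨n, hn⟩ := hfin.bddAbove
  refine ⟨n + 1, fun k hk i hi j hj hki hkj ↦ ?_⟩
  by_contra h
  have : k ≤ n := hn (Set.mem_biUnion (Finset.mem_product.2 ⟨hi, hj⟩ : (i, j) ∈ F ×ˢ F)
    (by simpa [h] using ⟨hki, hkj⟩))
  lia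

lemma norm_sum_indicator_le_one {ι : Type*} {A : ι → Set ℕ} {F : Finset ι} {k : ℕ}
    (h : ∀ i ∈ F, ∀ j ∈ F, k ∈ A i → k ∈ A j → i = j) {c : ι → ℂ} (hc : ∀ i, ‖c i‖ ≤ 1) :
    ‖∑ i ∈ F, c i * (A i).indicator 1 k‖ ≤ 1 := by
  by_cases hk : ∃ i ∈ F, k ∈ A i
  · obtain ⟨i, hi, hki⟩ := hk
    rw [Finset.sum_eq_single_of_mem i hi fun j hj hji ↦ by
      rw [Set.indicator_of_notMem fun hkj ↦ hji (h j hj i hi hkj hki), mul_zero]]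
    simpa [hki] using hc i
  · push Not at hk
    rw [Finset.sum_eq_zero fun i hi ↦ by rw [Set.indicator_of_notMem (hk i hi), mul_zero]]
    simp

end Chemin

end

theorem corollaryc (d : ℕ) (hd : 1 ≤ d) (χ : Chemin.Cutoff d) (s : ℝ) (hs : (d : ℝ) ≤ s) :
    ¬ ∃ G : Submodule ℂ (Chemin.Besov χ s 1), (Chemin.closureC χ s 1).IsTopCompl G := by
  rintro ⟨G, hG⟩
  obtain ⟨b, hb, hb0⟩ := χ.exists_isAnnular hd
  obtain ⟨A, hAinf, hA⟩ := Chemin.exists_almost_disjoint_family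
  obtain ⟨Λ, hΛ⟩ := Chemin.exists_functionals_separating χ s
  have hind : ∀ x k, ‖(A x).indicator (1 : ℕ → ℂ) k‖ ≤ 1 := fun x k ↦ by
    by_cases h : k ∈ A x <;> simp [h]
  choose f hf using fun x ↦ hb.exists_isLacunary s (hind x)
  have : Uncountable (ℕ → Bool) := by
    rw [← Cardinal.aleph0_lt_mk_iff]
    simpa using Cardinal.cantor Cardinal.aleph0
  obtain ⟨x, hx⟩ := Chemin.exists_mem_of_isTopCompl (f := f) (K := 1 * ∫ x, ‖𝓕⁻ b x‖)
    (Submodule.isClosed_topologicalClosure _) hG Λ hΛ fun F c hc ↦ by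
      obtain ⟨n, hn⟩ := Chemin.exists_forall_ge_at_most_one hA F
      have h1 := Chemin.IsLacunary.sum_smul F c fun i _ ↦ hf i
      obtain ⟨h, hhC, hh⟩ := hb.exists_truncation_mem_closureC s
        (fun k ↦ ∑ i ∈ F, c i * (A i).indicator 1 k) n
      -- Subtracting `h` removes the coefficients below `n`; beyond `n` each `k` lies in at most one
      -- of the sets, so at most one `c i` survives.
      refine ⟨h, hhC, (h1.sub hh).norm_le fun k ↦ ?_⟩
      by_cases hk : k < n
      · simp [hk]
      · rw [if_neg hk, sub_zero]
        exact Chemin.norm_sum_indicator_le_one (hn k (not_lt.1 hk)) hc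
  have h1 := Chemin.tendsto_lowFreq_of_mem_closureC hs hx
  -- The threshold is the modulus of the value of `lowFreq` at every `k ∈ A x`, and `A x` is
  -- infinite.
  have h2 : ∀ᶠ k in atTop, ‖Chemin.lowFreq χ s k (f x)‖ < ‖∫ ξ, b ξ‖ := by
    refine h1.norm.eventually_lt_const ?_
    rw [norm_zero]
    exact norm_pos_iff.2 hb0
  obtain ⟨n, hn⟩ := eventually_atTop.1 h2
  obtain ⟨k, hk, hnk⟩ := (hAinf x).exists_gt n
  have h3 := hn k hnk.le
  rw [Chemin.lowFreq_of_isLacunary hb (hf x), Set.indicator_of_mem hk] at h3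
  simp at h3
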